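/- Let $\mathbb T$ be the unit circle in $\mathbb C$. For $x,y\in\mathbb T$ say that there is an arc from $x$ to $y$, written $y\leftarrow x$, if $0<\arg(y/x)<2\pi/3$. Let $S=\{e^{iq}:q\in\mathbb Q\}$ be the set of points with rational argument (in radians), let $\mathbf S(3)$ be the directed graph induced on $S$, and let $G=\mathrm{Aut}(\mathbf S(3))$ carry the topology of pointwise convergence ($S$ discrete). $G$ acts on $(\{0,1\}^{S})^3$ (triples of subsets of $S$, product topology) by $x\in (g\cdot T)_j\iff g^{-1}(x)\in T_j$. For $j=0,1,2$ let $P^*_j$ be the set of $x\in S$ having an argument $\theta$ with $\frac{2j\pi}{3}<\theta+\frac{\pi}{6}<\frac{2(j+1)\pi}{3}$, and let $X^*=\overline{G\cdot(P_0^*,P_1^*,P_2^*)}\subset(\{0,1\}^S)^3$. Let $r$ be the rotation of $\mathbb T$ by the angle $-2\pi/3$, put $D=S\cup r(S)\cup r^{-1}(S)$, and let $$\tilde{\mathbb T}=(\mathbb T\setminus D)\cup (D\times\{0,1\})$$ be the circle with the points of $D$ doubled, with natural projection $p:\tilde{\mathbb T}\to\mathbb T$. For $\alpha,\beta\in D$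 with $\alpha\leftarrow\beta$ put $$[\alpha,\beta]=\{(\alpha,0)\}\cup\{t\in\tilde{\mathbb T}:\alpha\leftarrow p(t)\leftarrow\beta\}\cup\{(\beta,1)\}.$$ For $\vec T=(T_0,T_1,T_2)\in X^*$ let $t=\sup T_0$, where $x$ is regarded as smaller than $y$ when $x\leftarrow y$: that is, no $x\in T_0$ satisfies $t\leftarrow x$, and every $s\in\mathbb T$ with $s\leftarrow t$ satisfies $s\leftarrow x$ for some $x\in T_0$. Define $\varphi(\vec T)\in\tilde{\mathbb T}$ as follows. - If $t\notin D$, then $\varphi(\vec T)=t$. - If $t\in S$, then $\varphi(\vec T)=(t,0)$ if $t\in T_0$, and $(t,1)$ if $t\in T_2$. - If $t\in r(S)$, then $\varphi(\vec T)=(t,0)$ if $r^{-1}(t)\in T_1$, and $(t,1)$ if $r^{-1}(t)\in T_0$. - If $t\in r^{-1}(S)$, then $\varphi(\vec T)=(t,0)$ if $r(t)\in T_2$, and $(t,1)$ if $r(t)\in T_1$. **Proposition.** The sets $[\alpha,\beta]$ form a basis of a topology on $\tilde{\mathbb T}$, and $\varphi$ is a well-defined homeomorphism from $X^*$ onto $\tilde{\mathbb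 T}$ with this topology. Let $G$ act on $\tilde{\mathbb T}$ by transporting its action on $X^*$ through $\varphi$. Then $G\curvearrowright\tilde{\mathbb T}$ is the universal minimal flow of $G$. That is, $\tilde{\mathbb T}$ is a nonempty compact Hausdorff space, the action is continuous, every orbit is dense, and for every nonempty compact Hausdorff minimal $G$-flow $Y$ there is a continuous $G$-equivariant surjection $\tilde{\mathbb T}\to Y$. -/

import Mathlib

universe u

/-! ### Flows -/

/-- `X` is a compact minimal `G`-flow: a nonempty compact Hausdorff space with a (jointly)
continuous action of `G` all of whose orbits are dense. -/
structure IsCompactMinimalFlow (G X : Type*) [Group G] [TopologicalSpace G]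
    [TopologicalSpace X] [MulAction G X] : Prop where
  nonempty : Nonempty X
  compact : CompactSpace X
  hausdorff : T2Space X
  continuous : ContinuousSMul G X
  minimal : ∀ x : X, closure (MulAction.orbit G x) = Set.univ

/-- `X` is the universal minimal flow of `G`: it is a compact minimal flow, and every compact
minimal `G`-flow (in the universe `u₁`) is a factor of it. -/
def IsUniversalMinimalFlow.{u₁, v, w} (G : Type v) (X : Type w) [Group G] [TopologicalSpace G]
    [IsTopologicalGroup G] [TopologicalSpace X] [MulAction G X] : Prop :=
  IsCompactMinimalFlow G X ∧
    ∀ (Y : Type u₁) [TopologicalSpace Y] [MulAction G Y], IsCompactMinimalFlow G Y →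
      ∃ π : X → Y, Continuous π ∧ Function.Surjective π ∧
        ∀ (g : G) (x : X), π (g • x) = g • π x

namespace CircularDigraph

/-! ### The directed graph `S(3)` and its automorphism group -/

/-- There is an arc from `x` to `y` in the directed graph on the whole unit circle:
`0 < arg (y / x) < 2π/3`. -/
def Arc (x y : Circle) : Prop :=
  0 < Complex.arg ((y / x : Circle) : ℂ) ∧
    Complex.arg ((y / x : Circle) : ℂ) < 2 * Real.pi / 3

/-- The points `exp (i q)` of the unit circle with rational argument `q` (in radians). -/
def S : Set Circle := {z | ∃ q : ℚ, Circle.exp (q : ℝ) = z}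

/-- The arc relation of the directed graph `S(3)`, whose vertex set is `S`. -/
def arcS3 (x y : S) : Prop := Arc x y

/-- The automorphism group of `S(3)`. -/
abbrev AutS3 : Type := arcS3 ≃r arcS3

/-- The topology of pointwise convergence on `Aut(S(3))`, with `S` seen as a discrete set. -/
instance : TopologicalSpace AutS3 :=
  TopologicalSpace.generateFrom {U | ∃ x y : S, U = {g : AutS3 | g x = y}}

theorem isOpen_apply_eq (x y : S) : IsOpen {g : AutS3 | g x = y} :=
  TopologicalSpace.isOpen_generateFrom_of_mem ⟨x, y, rfl⟩

instance : IsTopologicalGroup AutS3 where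
  continuous_mul := by
    refine continuous_generateFrom_iff.2 ?_
    rintro _ ⟨x, y, rfl⟩
    have : (fun p : AutS3 × AutS3 => p.1 * p.2) ⁻¹' {g | g x = y} =
        ⋃ z : S, {g : AutS3 | g z = y} ×ˢ {h : AutS3 | h x = z} := by
      ext p
      simp only [Set.mem_preimage, Set.mem_ofPred_eq, Set.mem_iUnion, Set.mem_prod,
        RelIso.mul_apply]
      exact ⟨fun h => ⟨p.2 x, h, rfl⟩, fun ⟨z, h1, h2⟩ => by rw [h2, h1]⟩
    rw [this]
    exact isOpen_iUnion fun z => (isOpen_apply_eq z y).prod (isOpen_apply_eq x z)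
  continuous_inv := by
    refine continuous_generateFrom_iff.2 ?_
    rintro _ ⟨x, y, rfl⟩
    have : (fun g : AutS3 => g⁻¹) ⁻¹' {g | g x = y} = {g : AutS3 | g y = x} := by
      ext g
      constructor
      · rintro (h : g⁻¹ x = y)
        change g y = x
        rw [← h, RelIso.apply_inv_self]
      · rintro (h : g y = x)
        change g⁻¹ x = y
        rw [← h, RelIso.inv_apply_self]
    rw [this]
    exact isOpen_apply_eq y x

/-! ### The flow of `Aut(S(3))` on the closure of the orbit of the three sectors -/

/-- Triples of subsets of `S`, i.e. the compact space `({0,1}^S)^3` with its product topology. -/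
abbrev Triples : Type := Fin 3 → S → Bool

/-- The action on triples of subsets: `x ∈ (g • T)ⱼ` iff `g⁻¹ x ∈ Tⱼ`. -/
def translate (g : AutS3) (T : Triples) : Triples := fun j x => T j (g⁻¹ x)

open Classical in
/-- The three open sectors `2jπ/3 < arg x + π/6 < 2(j+1)π/3`, where `arg x` ranges over all
arguments of `x`. -/
noncomputable def sectors : Triples := fun j x =>
  decide (∃ θ : ℝ, Circle.exp θ = (x : Circle) ∧
    2 * ((j : ℕ) : ℝ) * Real.pi / 3 < θ + Real.pi / 6 ∧
    θ + Real.pi / 6 < 2 * (((j : ℕ) : ℝ) + 1) * Real.pi / 3)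

/-- `X*`, the closure of the orbit of the three sectors. -/
def orbitClosure : Set Triples := closure (Set.range fun g : AutS3 => translate g sectors)

theorem continuous_translate (g : AutS3) : Continuous (translate g) :=
  continuous_pi fun j => continuous_pi fun x =>
    (continuous_apply (g⁻¹ x)).comp (continuous_apply j)

theorem translate_mem (g : AutS3) {T : Triples} (hT : T ∈ orbitClosure) :
    translate g T ∈ orbitClosure := by
  refine map_mem_closure (continuous_translate g) hT ?_
  rintro _ ⟨h, rfl⟩
  exact ⟨g * h, by funext j x; simp [translate, RelIso.mul_apply]⟩

instance : MulAction AutS3 orbitClosure where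
  smul g T := ⟨translate g T, translate_mem g T.2⟩
  one_smul T := by
    apply Subtype.ext
    change translate 1 (T : Triples) = T
    funext j x
    simp [translate]
  mul_smul g h T := by
    apply Subtype.ext
    change translate (g * h) (T : Triples) = translate g (translate h T)
    funext j x
    simp [translate, RelIso.mul_apply]

/-! ### The circle with doubled points -/

/-- The rotation `r` of the unit circle of angle `-2π/3`. -/
noncomputable def rot : Circle ≃ Circle := Equiv.mulLeft (Circle.exp (-(2 * Real.pi / 3)))

/-- The set `S ∪ r(S) ∪ r⁻¹(S)` of the points to be doubled. -/
def doubledPts : Set Circle := S ∪ rot '' S ∪ rot.symm '' S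

/-- The circle in which every point `t` of `S ∪ r(S) ∪ r⁻¹(S)` is replaced by two points
`(t, 0)` and `(t, 1)`. -/
inductive DoubledCircle : Type
  | single (t : Circle) (ht : t ∉ doubledPts) : DoubledCircle
  | double (t : Circle) (ht : t ∈ doubledPts) (i : Fin 2) : DoubledCircle

/-- The natural projection to the circle. -/
def DoubledCircle.proj : DoubledCircle → Circle
  | .single t _ => t
  | .double t _ _ => t

/-- The set `[α, β]`. It consists of `(α, 0)`, of `(β, 1)`, and of all points whose projection `p`
satisfies: there are an arc from `p` to `α` and an arc from `β` to `p`. -/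
def interval (α β : Circle) (hα : α ∈ doubledPts) (hβ : β ∈ doubledPts) : Set DoubledCircle :=
  {.double α hα 0} ∪ {t | Arc t.proj α ∧ Arc β t.proj} ∪ {.double β hβ 1}

/-- The sets `[α, β]` with `α, β ∈ S ∪ r(S) ∪ r⁻¹(S)` such that there is an arc from `β` to `α`. -/
def intervals : Set (Set DoubledCircle) :=
  {U | ∃ (α β : Circle) (hα : α ∈ doubledPts) (hβ : β ∈ doubledPts),
    Arc β α ∧ U = interval α β hα hβ}

/-- The topology generated by the sets `[α, β]`. -/
instance : TopologicalSpace DoubledCircle := TopologicalSpace.generateFrom intervals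

/-! ### The identification of `X*` with the circle with doubled points -/

/-- `t` is the supremum of `A` for the arc relation, where `x` is regarded as smaller than `y`
if there is an arc from `y` to `x`: no element of `A` is larger than `t`, and everything smaller
than `t` is smaller than some element of `A`. -/
def IsSup (A : Set Circle) (t : Circle) : Prop :=
  (∀ x ∈ A, ¬ Arc x t) ∧ ∀ s, Arc t s → ∃ x ∈ A, Arc x s

/-- The supremum of the first member of a triple is `t`. -/
def SupFirst (T : Triples) (t : Circle) : Prop := IsSup {z | ∃ x : S, T 0 x = true ∧ z = x} t

theorem mem_doubledPts (s : S) : (s : Circle) ∈ doubledPts := Or.inl (Or.inl s.2)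

theorem rot_mem_doubledPts (s : S) : rot s ∈ doubledPts := Or.inl (Or.inr ⟨s, s.2, rfl⟩)

theorem rot_symm_mem_doubledPts (s : S) : rot.symm s ∈ doubledPts := Or.inr ⟨s, s.2, rfl⟩

/-- The graph of the coding map: `Codes T x` means that `x` is the point of the circle with doubled
points that codes the triple `T = (T₀, T₁, T₂)`. With `t = sup T₀`:
* if `t` is not a doubled point, the code is `t`;
* if `t = s` with `s ∈ S`, the code is `(t, 0)` if `s ∈ T₀` and `(t, 1)` if `s ∈ T₂`;
* if `t = r(s)` with `s ∈ S`, the code is `(t, 0)` if `s ∈ T₁` and `(t, 1)` if `s ∈ T₀`;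
* if `t = r⁻¹(s)` with `s ∈ S`, the code is `(t, 0)` if `s ∈ T₂` and `(t, 1)` if `s ∈ T₁`. -/
inductive Codes (T : Triples) : DoubledCircle → Prop
  | single (t : Circle) (ht : t ∉ doubledPts) (h : SupFirst T t) : Codes T (.single t ht)
  | zero (s : S) (h : SupFirst T s) (hs : T 0 s = true) :
      Codes T (.double s (mem_doubledPts s) 0)
  | one (s : S) (h : SupFirst T s) (hs : T 2 s = true) :
      Codes T (.double s (mem_doubledPts s) 1)
  | rot_zero (s : S) (h : SupFirst T (rot s)) (hs : T 1 s = true) :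
      Codes T (.double (rot s) (rot_mem_doubledPts s) 0)
  | rot_one (s : S) (h : SupFirst T (rot s)) (hs : T 0 s = true) :
      Codes T (.double (rot s) (rot_mem_doubledPts s) 1)
  | rot_symm_zero (s : S) (h : SupFirst T (rot.symm s)) (hs : T 2 s = true) :
      Codes T (.double (rot.symm s) (rot_symm_mem_doubledPts s) 0)
  | rot_symm_one (s : S) (h : SupFirst T (rot.symm s)) (hs : T 1 s = true) :
      Codes T (.double (rot.symm s) (rot_symm_mem_doubledPts s) 1)

end CircularDigraph

/-! A point `u` of the doubled circle is a cut. Each `x` in `S` has exactly one rotated copy, by a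
multiple of a third of a turn, in the sector of length `2π/3` that starts at `u`. The rotation index
is the colour of `x`, the place in the sector its position, and the colour classes form the triple
`tri u`. An undoubled cut turns `S` into a countable dense linear order with three dense colours,
from which the arcs can be read off (`arc_iff_position`). Back and forth
(`IsPartialIso.exists_equiv`) therefore extends finite maps preserving colour and order to
automorphisms (`exists_aut_extending`).

`X*` is exactly the set of triples of cuts. The sectors come from the cut at angle `-π/6`, and the
conditions `IsCut`, which involve at most three points at a time, pass to translates and limits and
force a triple to come from a cut (`IsCut.exists_eq_tri`). Conversely, on a finite set any cut
agrees with an undoubled one, to which an automorphism carries the sectors. The inverse of `tri` is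
the coding map, and a basic interval amounts to two coordinate conditions on triples
(`interval_eq`), so the topologies match.

Universality follows the method of Kechris, Pestov and Todorcevic. The stabilizer of the sectors is
the automorphism group of the three-coloured order; Ramsey's theorem gives it a fixed point `y₀` in
every compact flow of the whole group (`exists_monochromatic`, `exists_fixed`). If two translates of
the sectors by `g` and `g'` agree on a finite set, then `g` and `g'` differ by a stabilizer element
on the right and a small automorphism on the left (`exists_mul_eq_mul`). So the closure of the joint
orbit of (sectors, `y₀`) is the graph of a continuous equivariant map, which is onto when the target
is minimal. -/

open Set

/-! ### Ramsey's theorem -/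

theorem exists_strictMono_monochromatic {κ : Type*} [Finite κ] (n : ℕ) :
    ∀ χ : (Fin n → ℕ) → κ, ∃ H : ℕ → ℕ, StrictMono H ∧
      ∃ col, ∀ f : Fin n → ℕ, StrictMono f → χ (H ∘ f) = col := by
  induction n with
  | zero =>
    intro χ
    exact ⟨id, strictMono_id, χ Fin.elim0, fun f _ => congrArg χ (Subsingleton.elim _ _)⟩
  | succ n ih =>
    intro χ
    -- `A` enumerates the numbers still available. Its least value is kept as first entry and the
    -- induction hypothesis thins out the rest; the shift `+ 1` discards that least value.
    have step : ∀ A : {A : ℕ → ℕ // StrictMono A}, ∃ H : ℕ → ℕ, StrictMono H ∧ ∃ col,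
        ∀ f : Fin n → ℕ, StrictMono f →
          χ (Fin.cons (A.1 0) (fun i => A.1 (H (f i) + 1))) = col := fun A =>
      ih fun f => χ (Fin.cons (A.1 0) (fun i => A.1 (f i + 1)))
    choose H hH col hcol using step
    let next : {A : ℕ → ℕ // StrictMono A} → {A : ℕ → ℕ // StrictMono A} := fun A =>
      ⟨fun m => A.1 (H A m + 1), fun i j hij => A.2 (Nat.succ_lt_succ (hH A hij))⟩
    let seq : ℕ → {A : ℕ → ℕ // StrictMono A} := fun k => next^[k] ⟨id, strictMono_id⟩
    have hseq : ∀ k, seq (k + 1) = next (seq k) := fun k => Function.iterate_succ_apply' _ _ _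
    have hrange : ∀ k m, range (seq (k + m)).1 ⊆ range (seq k).1 := by
      intro k m
      induction m with
      | zero => exact subset_rfl
      | succ m ihm =>
        refine subset_trans ?_ ihm
        rw [← add_assoc, hseq]
        rintro _ ⟨i, rfl⟩
        exact ⟨_, rfl⟩
    set a : ℕ → ℕ := fun k => (seq k).1 0 with ha
    have amono : StrictMono a := by
      refine strictMono_nat_of_lt_succ fun k => ?_
      simp only [ha, hseq]
      exact (seq k).2 (Nat.succ_pos _)
    -- Along `a` the colour depends only on the first entry, so the pigeonhole principle on first
    -- entries finishes the proof.
    have key : ∀ f : Fin (n + 1) → ℕ, StrictMono f → χ (a ∘ f) = col (seq (f 0)) := by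
      intro f hf
      have : ∀ i : Fin n, ∃ m, (seq (f 0 + 1)).1 m = a (f i.succ) := by
        intro i
        obtain ⟨m, hm⟩ := Nat.exists_eq_add_of_lt (hf (Fin.succ_pos i))
        refine hrange (f 0 + 1) m ?_
        rw [show f 0 + 1 + m = f i.succ by omega]
        exact ⟨0, rfl⟩
      choose g hg using this
      have gmono : StrictMono g := by
        intro i j hij
        rw [← (seq (f 0 + 1)).2.lt_iff_lt, hg, hg]
        exact amono (hf (Fin.succ_lt_succ_iff.2 hij))
      rw [← hcol (seq (f 0)) g gmono]
      congr 1
      funext i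
      refine Fin.cases rfl (fun i => ?_) i
      rw [Fin.cons_succ, Function.comp_apply, ← hg, hseq]
    obtain ⟨c, hc⟩ := Finite.exists_infinite_fiber (fun k => col (seq k))
    have hc' : ((fun k => col (seq k)) ⁻¹' {c}).Infinite := Set.infinite_coe_iff.1 hc
    refine ⟨a ∘ Nat.nth (· ∈ (fun k => col (seq k)) ⁻¹' {c}),
      amono.comp (Nat.nth_strictMono hc'), c, fun f hf => ?_⟩
    exact (key _ ((Nat.nth_strictMono hc').comp hf)).trans (Nat.nth_mem_of_infinite hc' (f 0))

/-! ### Back and forth for densely coloured countable linear orders -/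

section BackAndForth

variable {α β ι : Type*}

/-- The points of `α`, placed at `δ` in the interval `(0, l)` and coloured by `c`, are pairwise
distinct and every colour is dense. -/
structure IsDenseColouring (c : α → ι) (δ : α → ℝ) (l : ℝ) : Prop where
  injective : Function.Injective δ
  mem : ∀ x, δ x ∈ Ioo 0 l
  dense : ∀ (j : ι) (p q : ℝ), 0 ≤ p → p < q → q ≤ l → ∃ x, c x = j ∧ p < δ x ∧ δ x < q

/-- A finite set of pairs that preserves colours and the order of positions. -/
def IsPartialIso (c : α → ι) (δ : α → ℝ) (d : β → ι) (ε : β → ℝ) (f : Finset (α × β)) : Prop :=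
  ∀ p ∈ f, c p.1 = d p.2 ∧ ∀ q ∈ f, (δ p.1 < δ q.1 ↔ ε p.2 < ε q.2)

variable {c : α → ι} {δ : α → ℝ} {d : β → ι} {ε : β → ℝ} {l : ℝ}

-- Finitely many points leave a gap for the image of `a`, and the required colour is dense there.
open Classical in
theorem IsPartialIso.exists_insert (hd : IsDenseColouring d ε l) (hδ : Function.Injective δ)
    (hl : 0 < l)
    {f : Finset (α × β)} (hf : IsPartialIso c δ d ε f) (a : α) :
    ∃ b, IsPartialIso c δ d ε (insert (a, b) f) := by
  by_cases ha : ∃ p ∈ f, p.1 = a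
  · obtain ⟨p, hp, rfl⟩ := ha
    exact ⟨p.2, by rwa [Finset.insert_eq_of_mem hp]⟩
  push Not at ha
  -- The ends `0` and `l` serve as bounds when no matched point lies on that side of `a`.
  let lo := insert 0 ((f.filter fun p => δ p.1 < δ a).image fun p => ε p.2)
  let hi := insert l ((f.filter fun p => δ a < δ p.1).image fun p => ε p.2)
  have hlo : lo.Nonempty := Finset.insert_nonempty _ _
  have hhi : hi.Nonempty := Finset.insert_nonempty _ _
  have hlt : lo.max' hlo < hi.min' hhi := by
    rw [Finset.max'_lt_iff]
    intro x hx
    rw [Finset.lt_min'_iff]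
    intro y hy
    simp only [lo, hi, Finset.mem_insert, Finset.mem_image, Finset.mem_filter] at hx hy
    rcases hx with rfl | ⟨p, ⟨hp, hpa⟩, rfl⟩ <;> rcases hy with rfl | ⟨q, ⟨hq, hqa⟩, rfl⟩
    · exact hl
    · exact (hd.mem _).1
    · exact (hd.mem _).2
    · exact ((hf p hp).2 q hq).1 (hpa.trans hqa)
  obtain ⟨b, hb, hb1, hb2⟩ := hd.dense (c a) (lo.max' hlo) (hi.min' hhi)
    (Finset.le_max' _ _ (Finset.mem_insert_self _ _)) hlt
    (Finset.min'_le _ _ (Finset.mem_insert_self _ _))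
  have h1 : ∀ p ∈ f, δ p.1 < δ a → ε p.2 < ε b := fun p hp h =>
    (Finset.le_max' lo _ (Finset.mem_insert_of_mem (Finset.mem_image_of_mem _
      (Finset.mem_filter.2 ⟨hp, h⟩)))).trans_lt hb1
  have h2 : ∀ p ∈ f, δ a < δ p.1 → ε b < ε p.2 := fun p hp h =>
    hb2.trans_le (Finset.min'_le hi _ (Finset.mem_insert_of_mem (Finset.mem_image_of_mem _
      (Finset.mem_filter.2 ⟨hp, h⟩))))
  have h3 : ∀ p ∈ f, δ p.1 ≠ δ a := fun p hp h => ha p hp (hδ h)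
  refine ⟨b, fun p hp => ?_⟩
  rw [Finset.mem_insert] at hp
  rcases hp with rfl | hp
  · refine ⟨hb.symm, fun q hq => ?_⟩
    rw [Finset.mem_insert] at hq
    rcases hq with rfl | hq
    · simp
    · refine ⟨h2 q hq, fun h => ?_⟩
      rcases lt_or_gt_of_ne (h3 q hq) with h' | h'
      · exact absurd h (h1 q hq h').asymm
      · exact h'
  · refine ⟨(hf p hp).1, fun q hq => ?_⟩
    rw [Finset.mem_insert] at hq
    rcases hq with rfl | hq
    · refine ⟨h1 p hp, fun h => ?_⟩
      rcases lt_or_gt_of_ne (h3 p hp) with h' | h'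
      · exact h'
      · exact absurd h (h2 p hp h').asymm
    · exact (hf p hp).2 q hq

open Classical in
theorem IsPartialIso.swap {f : Finset (α × β)} (hf : IsPartialIso c δ d ε f) :
    IsPartialIso d ε c δ (f.image Prod.swap) := by
  intro p hp
  obtain ⟨p, hp', rfl⟩ := Finset.mem_image.1 hp
  refine ⟨(hf p hp').1.symm, fun q hq => ?_⟩
  obtain ⟨q, hq', rfl⟩ := Finset.mem_image.1 hq
  exact ((hf p hp').2 q hq').symm

open Classical in
theorem IsPartialIso.exists_insert' (hc : IsDenseColouring c δ l) (hε : Function.Injective ε)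
    (hl : 0 < l)
    {f : Finset (α × β)} (hf : IsPartialIso c δ d ε f) (b : β) :
    ∃ a, IsPartialIso c δ d ε (insert (a, b) f) := by
  obtain ⟨a, ha⟩ := hf.swap.exists_insert hc hε hl b
  refine ⟨a, ?_⟩
  have := ha.swap
  rwa [Finset.image_insert, Finset.image_image, Prod.swap_swap_eq, Finset.image_id] at this

/-- Back and forth as a genericity argument: an ideal of finite partial maps meets the countably
many cofinal sets "`a` is in the domain" and "`b` is in the range", and its union is the bijection.
-/
theorem IsPartialIso.exists_equiv [Countable α] [Countable β] (hc : IsDenseColouring c δ l)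
    (hd : IsDenseColouring d ε l) (hl : 0 < l) {f₀ : Finset (α × β)}
    (hf₀ : IsPartialIso c δ d ε f₀) :
    ∃ e : α ≃ β, (∀ x, d (e x) = c x) ∧ (∀ x y, δ x < δ y ↔ ε (e x) < ε (e y)) ∧
      ∀ p ∈ f₀, e p.1 = p.2 := by
  classical
  have := Encodable.ofCountable α
  have := Encodable.ofCountable β
  let P := {f : Finset (α × β) // IsPartialIso c δ d ε f}
  let D : α ⊕ β → Order.Cofinal P := fun s =>
    { carrier := {f | Sum.elim (fun a => ∃ b, (a, b) ∈ f.1) (fun b => ∃ a, (a, b) ∈ f.1) s}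
      isCofinal := by
        rintro ⟨f, hf⟩
        rcases s with a | b
        · obtain ⟨b, hb⟩ := hf.exists_insert hd hc.injective hl a
          exact ⟨⟨_, hb⟩, ⟨b, Finset.mem_insert_self _ _⟩, Finset.subset_insert _ _⟩
        · obtain ⟨a, ha⟩ := hf.exists_insert' hc hd.injective hl b
          exact ⟨⟨_, ha⟩, ⟨a, Finset.mem_insert_self _ _⟩, Finset.subset_insert _ _⟩ }
  let I := Order.idealOfCofinals (⟨f₀, hf₀⟩ : P) D
  let R : Set (α × β) := {p | ∃ f ∈ I, p ∈ f.1}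
  have hR : ∀ p ∈ R, ∀ q ∈ R, c p.1 = d p.2 ∧ (δ p.1 < δ q.1 ↔ ε p.2 < ε q.2) := by
    rintro p ⟨f, hf, hp⟩ q ⟨g, hg, hq⟩
    obtain ⟨m, -, hfm, hgm⟩ := I.directed f hf g hg
    exact ⟨(m.2 p (hfm hp)).1, (m.2 p (hfm hp)).2 q (hgm hq)⟩
  have hl' : ∀ a, ∃ b, (a, b) ∈ R := fun a => by
    obtain ⟨f, ⟨b, hb⟩, hf⟩ := Order.cofinal_meets_idealOfCofinals (⟨f₀, hf₀⟩ : P) D (Sum.inl a)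
    exact ⟨b, f, hf, hb⟩
  have hr' : ∀ b, ∃ a, (a, b) ∈ R := fun b => by
    obtain ⟨f, ⟨a, ha⟩, hf⟩ := Order.cofinal_meets_idealOfCofinals (⟨f₀, hf₀⟩ : P) D (Sum.inr b)
    exact ⟨a, f, hf, ha⟩
  choose u hu using hl'
  choose v hv using hr'
  have funct : ∀ a b b', (a, b) ∈ R → (a, b') ∈ R → b = b' := fun a b b' h h' =>
    hd.injective (le_antisymm
      (not_lt.1 fun hh => lt_irrefl _ ((hR _ h' _ h).2.2 hh))
      (not_lt.1 fun hh => lt_irrefl _ ((hR _ h _ h').2.2 hh)))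
  have funct' : ∀ a a' b, (a, b) ∈ R → (a', b) ∈ R → a = a' := fun a a' b h h' =>
    hc.injective (le_antisymm
      (not_lt.1 fun hh => lt_irrefl _ ((hR _ h' _ h).2.1 hh))
      (not_lt.1 fun hh => lt_irrefl _ ((hR _ h _ h').2.1 hh)))
  refine ⟨⟨u, v, fun a => funct' _ _ _ (hv (u a)) (hu a), fun b => funct _ _ _ (hu (v b)) (hv b)⟩,
    fun x => (hR _ (hu x) _ (hu x)).1.symm, fun x y => (hR _ (hu x) _ (hu y)).2, fun p hp => ?_⟩
  exact funct _ _ _ (hu p.1) ⟨_, Order.mem_idealOfCofinals _ _, hp⟩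

end BackAndForth

namespace CircularDigraph

/-! ### Arcs and rotations by thirds of a turn -/

/-- The angle `2π/3`. -/
noncomputable def third : ℝ := 2 * Real.pi / 3

theorem third_pos : 0 < third := by
  have := Real.pi_pos
  unfold third
  positivity

theorem two_pi_eq : 2 * Real.pi = 3 * third := by unfold third; ring

theorem arc_iff {x y : Circle} : Arc x y ↔ ∃ δ ∈ Ioo 0 third, y = x * Circle.exp δ := by
  constructor
  · intro h
    refine ⟨_, h, ?_⟩
    rw [Circle.exp_arg, mul_div_cancel]
  · rintro ⟨δ, hδ, rfl⟩
    have h1 := third_pos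
    have h2 := two_pi_eq
    have : Complex.arg ((x * Circle.exp δ / x : Circle) : ℂ) = δ := by
      rw [mul_div_cancel_left]
      exact Circle.arg_exp (by linarith [hδ.1]) (by linarith [hδ.2])
    unfold Arc
    rw [this]
    exact hδ

theorem exp_eq_exp_iff {a b : ℝ} :
    Circle.exp a = Circle.exp b ↔ ∃ m : ℤ, a = b + 3 * m * third := by
  rw [Circle.exp_eq_exp]
  refine exists_congr fun m => ?_
  rw [two_pi_eq]
  constructor <;> intro h <;> rw [h] <;> ring

theorem int_eq_zero_of_abs_lt {k : ℤ} (h1 : -third < k * third) (h2 : k * third < third) :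
    k = 0 := by
  have h := third_pos
  have h1' : (-1 : ℝ) < k := by by_contra! hh; nlinarith
  have h2' : (k : ℝ) < 1 := by by_contra! hh; nlinarith
  have h3 : -1 < k := by exact_mod_cast h1'
  have h4 : k < 1 := by exact_mod_cast h2'
  omega

/-- The bounds are the widest closed range of `b - a` in which a whole turn, `3 * third`, cannot
bring another value into `(0, third)`. -/
theorem arc_mul_exp {t : Circle} {a b : ℝ} (h1 : -(2 * third) ≤ b - a) (h2 : b - a ≤ 3 * third) :
    Arc (t * Circle.exp a) (t * Circle.exp b) ↔ 0 < b - a ∧ b - a < third := by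
  have h := third_pos
  rw [arc_iff]
  constructor
  · rintro ⟨δ, ⟨hδ, hδ'⟩, h3⟩
    rw [mul_assoc, ← Circle.exp_add, mul_right_inj, exp_eq_exp_iff] at h3
    obtain ⟨m, hm⟩ := h3
    have h4 : (-1 : ℝ) < m := by by_contra! hh; nlinarith
    have h5 : (m : ℝ) < 1 := by by_contra! hh; nlinarith
    have h6 : -1 < m := by exact_mod_cast h4
    have h7 : m < 1 := by exact_mod_cast h5
    obtain rfl : m = 0 := by omega
    constructor <;> simp at hm <;> linarith
  · rintro ⟨h3, h4⟩
    exact ⟨b - a, ⟨h3, h4⟩, by rw [mul_assoc, ← Circle.exp_add]; congr 2; ring⟩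

/-- Rotation by the angle `-2jπ/3`. -/
noncomputable def rho (j : Fin 3) (x : Circle) : Circle :=
  x * Circle.exp (-(third * ((j : ℕ) : ℝ)))

theorem rho_mul_exp (j : Fin 3) (t : Circle) (δ : ℝ) :
    rho j (t * Circle.exp δ) = t * Circle.exp (δ - third * ((j : ℕ) : ℝ)) := by
  unfold rho; rw [mul_assoc, ← Circle.exp_add, sub_eq_add_neg]

@[simp] theorem rho_zero (x : Circle) : rho 0 x = x := by simp [rho]

theorem rho_rho (i j : Fin 3) (x : Circle) : rho i (rho j x) = rho (i + j) x := by
  unfold rho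
  rw [mul_assoc, mul_right_inj, ← Circle.exp_add, exp_eq_exp_iff]
  have : ∃ m : ℤ, ((i : ℕ) : ℤ) + ((j : ℕ) : ℤ) = (((i + j : Fin 3) : ℕ) : ℤ) + 3 * m := by
    refine ⟨(i + j : ℕ) / 3, ?_⟩
    rw [Fin.val_add]
    push_cast
    omega
  obtain ⟨m, hm⟩ := this
  refine ⟨-m, ?_⟩
  have hm' : ((i : ℕ) : ℝ) + ((j : ℕ) : ℝ) = (((i + j : Fin 3) : ℕ) : ℝ) + 3 * m := by
    exact_mod_cast hm
  push_cast
  linear_combination (-third) * hm'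

theorem rho_injective (j : Fin 3) : Function.Injective (rho j) := fun _ _ h =>
  mul_right_cancel h

theorem rot_eq (x : Circle) : rot x = rho 1 x := by
  simp [rot, rho, third, mul_comm]

theorem rot_symm_eq (x : Circle) : rot.symm x = rho 2 x := by
  rw [Equiv.symm_apply_eq, rot_eq, rho_rho]
  exact (rho_zero x).symm

theorem arc_rho_rho (i j : Fin 3) (x y : Circle) :
    Arc (rho i x) (rho j y) ↔ Arc x (rho (j - i) y) := by
  have : ∀ k x y, Arc (rho k x) (rho k y) ↔ Arc x y := by
    intro k x y
    unfold Arc rho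
    rw [mul_div_mul_right_eq_div]
  rw [← this i x, rho_rho, add_sub_cancel]

/-- `rho 2` is the rotation by `+third`, so going forward by `third - ε` to the copy of `y` is going
back by `ε` to `y`. -/
theorem arc_rho_two {x y : Circle} : Arc x (rho 2 y) ↔ Arc y x := by
  have h := third_pos
  obtain ⟨δ, hδ⟩ := Circle.exp_surjective (y / x)
  obtain rfl : y = x * Circle.exp δ := by rw [hδ, mul_div_cancel]
  rw [arc_iff, arc_iff]
  constructor
  · rintro ⟨ε, hε, h1⟩
    refine ⟨third - ε, ⟨by linarith [hε.2], by linarith [hε.1]⟩, ?_⟩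
    rw [rho_mul_exp, mul_right_inj, exp_eq_exp_iff] at h1
    obtain ⟨m, hm⟩ := h1
    have h2 : Circle.exp (δ + (third - ε)) = Circle.exp 0 := by
      rw [exp_eq_exp_iff]
      refine ⟨m + 1, ?_⟩
      simp at hm
      push_cast
      linarith
    rw [mul_assoc, ← Circle.exp_add, h2, Circle.exp_zero, mul_one]
  · rintro ⟨ε, hε, h1⟩
    refine ⟨third - ε, ⟨by linarith [hε.2], by linarith [hε.1]⟩, ?_⟩
    rw [mul_assoc, ← Circle.exp_add, left_eq_mul, ← Circle.exp_zero, exp_eq_exp_iff] at h1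
    obtain ⟨m, hm⟩ := h1
    rw [rho_mul_exp, mul_right_inj, exp_eq_exp_iff]
    refine ⟨m - 1, ?_⟩
    simp
    linarith

theorem arc_rot {x y : Circle} : Arc x (rot.symm y) ↔ Arc y x := by rw [rot_symm_eq, arc_rho_two]

theorem rho_mul_exp_inj {t : Circle} {i j : Fin 3} {δ ε : ℝ} (h1 : -third < δ - ε)
    (h2 : δ - ε < third) (h : rho i (t * Circle.exp δ) = rho j (t * Circle.exp ε)) :
    i = j ∧ δ = ε := by
  rw [rho_mul_exp, rho_mul_exp, mul_right_inj, exp_eq_exp_iff] at h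
  obtain ⟨m, hm⟩ := h
  have h3 : δ - ε = (((i : ℕ) : ℤ) - ((j : ℕ) : ℤ) + 3 * m : ℤ) * third := by
    push_cast
    linear_combination hm
  have h4 : ((i : ℕ) : ℤ) - ((j : ℕ) : ℤ) + 3 * m = 0 :=
    int_eq_zero_of_abs_lt (by rwa [← h3]) (by rwa [← h3])
  rw [h4] at h3
  refine ⟨Fin.ext (by omega), by simpa [sub_eq_zero] using h3⟩

theorem exists_rho_eq (m : ℤ) : ∃ j : Fin 3, ∀ x, rho j x = x * Circle.exp (m * third) := by
  refine ⟨⟨((-m) % 3).toNat, by omega⟩, fun x => ?_⟩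
  unfold rho
  rw [mul_right_inj, exp_eq_exp_iff]
  obtain ⟨k, hk⟩ : ∃ k : ℤ, (((-m) % 3).toNat : ℤ) = -m - 3 * k := ⟨(-m) / 3, by omega⟩
  refine ⟨k, ?_⟩
  have hk' : ((((-m) % 3).toNat : ℕ) : ℝ) = -m - 3 * k := by exact_mod_cast hk
  simp only [hk']
  ring

theorem exists_rho_Ico (t a : Circle) : ∃ j, ∃ δ ∈ Ico 0 third, rho j a = t * Circle.exp δ := by
  obtain ⟨δ, hδ⟩ := Circle.exp_surjective (a / t)
  obtain rfl : a = t * Circle.exp δ := by rw [hδ, mul_div_cancel]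
  obtain ⟨m, hm, -⟩ := existsUnique_add_zsmul_mem_Ico third_pos δ 0
  obtain ⟨j, hj⟩ := exists_rho_eq m
  refine ⟨j, _, by simpa using hm, ?_⟩
  rw [hj, mul_assoc, ← Circle.exp_add]

theorem exists_rho_Ioc (t a : Circle) : ∃ j, ∃ δ ∈ Ioc 0 third, rho j a = t * Circle.exp δ := by
  obtain ⟨δ, hδ⟩ := Circle.exp_surjective (a / t)
  obtain rfl : a = t * Circle.exp δ := by rw [hδ, mul_div_cancel]
  obtain ⟨m, hm, -⟩ := existsUnique_add_zsmul_mem_Ioc third_pos δ 0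
  obtain ⟨j, hj⟩ := exists_rho_eq m
  refine ⟨j, _, by simpa using hm, ?_⟩
  rw [hj, mul_assoc, ← Circle.exp_add]

/-! ### Points with rational argument and their rotations -/

/-- Two rational angles cannot differ by a nonzero multiple of `2π/3`, because `π` is irrational. -/
theorem rho_inj_of_mem {x y : S} {i j : Fin 3} (h : rho i x = rho j y) : i = j ∧ x = y := by
  obtain ⟨_, q, rfl⟩ := x
  obtain ⟨_, q', rfl⟩ := y
  dsimp only at h
  have h' := h
  unfold rho at h
  rw [← Circle.exp_add, ← Circle.exp_add, exp_eq_exp_iff] at h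
  obtain ⟨m, hm⟩ := h
  have h3 : (q : ℝ) - q' = (((i : ℕ) : ℤ) - ((j : ℕ) : ℤ) + 3 * m : ℤ) * third := by
    push_cast
    linear_combination hm
  have h4 : ((i : ℕ) : ℤ) - ((j : ℕ) : ℤ) + 3 * m = 0 := by
    by_contra h4
    set k := ((i : ℕ) : ℤ) - ((j : ℕ) : ℤ) + 3 * m
    have hk : (k : ℝ) ≠ 0 := by exact_mod_cast h4
    refine irrational_pi ⟨3 * (q - q') / (2 * k), ?_⟩
    push_cast
    rw [h3]
    unfold third
    field_simp
  obtain rfl : i = j := Fin.ext (by omega)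
  exact ⟨rfl, Subtype.ext (rho_injective _ h')⟩

theorem mem_doubledPts_iff {t : Circle} : t ∈ doubledPts ↔ ∃ (s : S) (j : Fin 3), t = rho j s := by
  constructor
  · rintro ((h | ⟨s, hs, rfl⟩) | ⟨s, hs, rfl⟩)
    · exact ⟨⟨t, h⟩, 0, (rho_zero t).symm⟩
    · exact ⟨⟨s, hs⟩, 1, rot_eq s⟩
    · exact ⟨⟨s, hs⟩, 2, rot_symm_eq s⟩
  · rintro ⟨s, j, rfl⟩
    fin_cases j
    · exact (rho_zero (s : Circle)).symm ▸ mem_doubledPts s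
    · exact rot_eq s ▸ rot_mem_doubledPts s
    · exact rot_symm_eq s ▸ rot_symm_mem_doubledPts s

theorem rho_coe_mem (j : Fin 3) (s : S) : rho j s ∈ doubledPts := mem_doubledPts_iff.2 ⟨s, j, rfl⟩

theorem rho_mem_doubledPts {t : Circle} (j : Fin 3) : rho j t ∈ doubledPts ↔ t ∈ doubledPts := by
  have : ∀ (j : Fin 3) (t : Circle), t ∈ doubledPts → rho j t ∈ doubledPts := by
    intro j t h
    obtain ⟨s, i, rfl⟩ := mem_doubledPts_iff.1 h
    rw [rho_rho]
    exact rho_coe_mem _ _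
  refine ⟨fun h => ?_, this j t⟩
  have := this (-j) _ h
  rwa [rho_rho, neg_add_cancel, rho_zero] at this

theorem mul_exp_third_mem {t : Circle} : t * Circle.exp third ∈ doubledPts ↔ t ∈ doubledPts := by
  obtain ⟨j, hj⟩ := exists_rho_eq 1
  rw [← rho_mem_doubledPts j (t := t), hj, Int.cast_one, one_mul]

instance : Countable S := by
  have : S = range fun q : ℚ => Circle.exp (q : ℝ) := rfl
  rw [this]
  exact (countable_range _).to_subtype

theorem exists_mem_rho_eq (t : Circle) (j : Fin 3) {p q : ℝ} (h : p < q) :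
    ∃ x : S, ∃ δ, p < δ ∧ δ < q ∧ rho j x = t * Circle.exp δ := by
  obtain ⟨τ, rfl⟩ := Circle.exp_surjective t
  obtain ⟨r, hr, hr'⟩ := exists_rat_btwn
    (show τ + p + third * ((j : ℕ) : ℝ) < τ + q + third * ((j : ℕ) : ℝ) by linarith)
  refine ⟨⟨_, r, rfl⟩, r - third * ((j : ℕ) : ℝ) - τ, by linarith, by linarith, ?_⟩
  unfold rho
  rw [← Circle.exp_add, ← Circle.exp_add]
  congr 1
  ring

theorem exists_notMem_doubledPts (t : Circle) {p q : ℝ} (h : p < q) :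
    ∃ ε, p < ε ∧ ε < q ∧ t * Circle.exp ε ∉ doubledPts := by
  obtain ⟨τ, rfl⟩ := Circle.exp_surjective t
  have hc : (range fun x : ℚ × ℤ × ℤ => (x.1 : ℝ) + x.2.1 * third + 3 * x.2.2 * third - τ).Countable :=
    countable_range _
  obtain ⟨ε, h1, h2⟩ := (hc.dense_compl ℝ).exists_between h
  refine ⟨ε, h2.1, h2.2, fun h3 => h1 ?_⟩
  obtain ⟨⟨_, r, rfl⟩, j, hj⟩ := mem_doubledPts_iff.1 h3
  unfold rho at hj
  rw [← Circle.exp_add, ← Circle.exp_add, exp_eq_exp_iff] at hj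
  obtain ⟨m, hm⟩ := hj
  refine ⟨(r, -((j : ℕ) : ℤ), m), ?_⟩
  push_cast
  linarith

/-! ### Cuts of the circle and the triples they define -/

theorem arc_asymm {x y : Circle} (h : Arc x y) : ¬ Arc y x := by
  have h0 := third_pos
  obtain ⟨δ, hδ, rfl⟩ := arc_iff.1 h
  have := arc_mul_exp (t := x) (a := δ) (b := 0) (by linarith [hδ.2]) (by linarith [hδ.1])
  rw [Circle.exp_zero, mul_one] at this
  rw [this]
  intro hh
  linarith [hδ.1, hh.1]

/-- The angular positions, relative to the projection of `u`, of the points that follow the cut `u`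
by less than a third of a turn. -/
def DoubledCircle.sector : DoubledCircle → Set ℝ
  | .single _ _ => Ioo 0 third
  | .double _ _ i => if i = 0 then Ico 0 third else Ioc 0 third

open DoubledCircle

theorem DoubledCircle.forall_of {P : DoubledCircle → Prop} (h : ∀ t ht, P (single t ht))
    (h0 : ∀ t ht, P (double t ht 0)) (h1 : ∀ t ht, P (double t ht 1)) (u : DoubledCircle) : P u := by
  rcases u with ⟨t, ht⟩ | ⟨t, ht, i⟩
  · exact h t ht
  · fin_cases i
    · exact h0 t ht
    · exact h1 t ht

variable {u v : DoubledCircle} {p q r : ℝ}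

theorem sector_subset (u : DoubledCircle) : u.sector ⊆ Icc 0 third := by
  induction u using DoubledCircle.forall_of with
  | h => exact Ioo_subset_Icc_self
  | h0 => exact Ico_subset_Icc_self
  | h1 => exact Ioc_subset_Icc_self

theorem subset_sector (u : DoubledCircle) : Ioo 0 third ⊆ u.sector := by
  induction u using DoubledCircle.forall_of with
  | h => exact subset_rfl
  | h0 => exact Ioo_subset_Ico_self
  | h1 => exact Ioo_subset_Ioc_self

/-- No sector contains both of its ends; this strictness makes rotated copies and arcs unambiguous
inside a sector. -/
theorem sub_lt_third : ∀ u : DoubledCircle, p ∈ u.sector → q ∈ u.sector → p - q < third := by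
  refine DoubledCircle.forall_of (fun _ _ => ?_) (fun _ _ => ?_) (fun _ _ => ?_)
  all_goals
    rintro ⟨h1, h2⟩ ⟨h3, h4⟩
    linarith

theorem mem_sector_of_between (hp : p ∈ u.sector) (hq : q ∈ u.sector) (h1 : p ≤ r) (h2 : r ≤ q) :
    r ∈ u.sector := by
  have : u.sector.OrdConnected := by
    induction u using DoubledCircle.forall_of with
    | h => exact ordConnected_Ioo
    | h0 => exact ordConnected_Ico
    | h1 => exact ordConnected_Ioc
  exact this.out hp hq ⟨h1, h2⟩

theorem arc_of_mem_sector (hp : p ∈ u.sector) (hq : q ∈ u.sector) :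
    Arc (u.proj * Circle.exp p) (u.proj * Circle.exp q) ↔ p < q := by
  have h := third_pos
  have h1 := sub_lt_third u hp hq
  have h2 := sub_lt_third u hq hp
  rw [arc_mul_exp (by linarith) (by linarith)]
  exact ⟨fun h => by linarith [h.1], fun h => ⟨by linarith, by linarith⟩⟩

/-- The point `a` follows the cut `u` by less than a third of a turn. -/
def After (u : DoubledCircle) (a : Circle) : Prop :=
  ∃ δ ∈ u.sector, a = u.proj * Circle.exp δ

theorem after_mul_exp (h : p ∈ u.sector) : After u (u.proj * Circle.exp p) := ⟨p, h, rfl⟩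

theorem eq_of_after {i j : Fin 3} {a : Circle} (hi : After u (rho i a)) (hj : After u (rho j a)) :
    i = j := by
  obtain ⟨p, hp, h1⟩ := hi
  obtain ⟨q, hq, h2⟩ := hj
  have h3 : rho (j - i) (u.proj * Circle.exp p) = rho 0 (u.proj * Circle.exp q) := by
    rw [← h1, ← h2, rho_rho, sub_add_cancel, rho_zero]
  have h4 := sub_lt_third u hp hq
  have h5 := sub_lt_third u hq hp
  exact (sub_eq_zero.1 (rho_mul_exp_inj (by linarith) h4 h3).1).symm

/-- Reduce the angle from the cut to `a` modulo `third`. At an undoubled cut the remainder cannot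
vanish, since doubled points are stable under `rho`. -/
theorem exists_after {a : Circle} (ha : a ∈ doubledPts) (u : DoubledCircle) :
    ∃ j, After u (rho j a) := by
  induction u using DoubledCircle.forall_of with
  | h t ht =>
    obtain ⟨j, δ, hδ, h⟩ := exists_rho_Ico t a
    refine ⟨j, δ, ⟨hδ.1.lt_of_ne ?_, hδ.2⟩, h⟩
    rintro rfl
    rw [Circle.exp_zero, mul_one] at h
    exact ht (h ▸ (rho_mem_doubledPts j).2 ha)
  | h0 t ht =>
    obtain ⟨j, δ, hδ, h⟩ := exists_rho_Ico t a
    exact ⟨j, δ, hδ, h⟩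
  | h1 t ht =>
    obtain ⟨j, δ, hδ, h⟩ := exists_rho_Ioc t a
    exact ⟨j, δ, hδ, h⟩

/-- Convexity: the two parametrizations can only differ by whole turns, and both differences are
below `third`, so they run through the same short arc. -/
theorem after_of_between (hp : p ∈ u.sector) (hq : q ∈ u.sector)
    (h1 : p ≤ r) (h2 : r ≤ q) (h3 : After v (u.proj * Circle.exp p))
    (h4 : After v (u.proj * Circle.exp q)) : After v (u.proj * Circle.exp r) := by
  have h0 := third_pos
  have hr := mem_sector_of_between hp hq h1 h2
  obtain ⟨a, ha, ha'⟩ := h3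
  obtain ⟨b, hb, hb'⟩ := h4
  have hqp := sub_lt_third u hq hp
  have hab := sub_lt_third v ha hb
  have hba := sub_lt_third v hb ha
  have hv : v.proj = u.proj * Circle.exp (p - a) := by
    rw [Circle.exp_sub, ← mul_div_assoc, ha', mul_div_cancel_right]
  have hd : b - a = q - p := by
    rw [hv, mul_assoc, mul_right_inj, ← Circle.exp_add, exp_eq_exp_iff] at hb'
    obtain ⟨m, hm⟩ := hb'
    have h7 : (-1 : ℝ) < m := by by_contra! hh; nlinarith
    have h8 : (m : ℝ) < 1 := by by_contra! hh; nlinarith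
    have h9 : -1 < m := by exact_mod_cast h7
    have h10 : m < 1 := by exact_mod_cast h8
    obtain rfl : m = 0 := by omega
    simp at hm
    linarith
  refine ⟨a + (r - p), mem_sector_of_between ha hb (by linarith) (by linarith), ?_⟩
  rw [Circle.exp_add, ← mul_assoc, ← ha', mul_assoc, ← Circle.exp_add]
  congr 2
  ring

open Classical in
/-- The triple of subsets of `S` defined by the cut `u`: the `j`-th set consists of the points
following `u` by an angle between `2jπ/3` and `2(j+1)π/3`. -/
noncomputable def tri (u : DoubledCircle) : Triples := fun j x => decide (After u (rho j x))

theorem tri_eq_true {j : Fin 3} {x : S} : tri u j x = true ↔ After u (rho j x) := by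
  simp [tri]

theorem existsUnique_tri (u : DoubledCircle) (x : S) : ∃! j, tri u j x = true := by
  simp only [tri_eq_true]
  obtain ⟨j, hj⟩ := exists_after (mem_doubledPts x) u
  exact ⟨j, hj, fun i hi => eq_of_after hi hj⟩

theorem eq_of_existsUnique {T T' : Triples} {x : S} (h : ∃! j, T j x = true)
    (h' : ∃! j, T' j x = true) (himp : ∀ j, T j x = true → T' j x = true) (j : Fin 3) :
    T j x = T' j x := by
  rw [Bool.eq_iff_iff]
  refine ⟨himp j, fun hj => ?_⟩
  obtain ⟨i, hi, -⟩ := h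
  rwa [h'.unique hj (himp i hi)]

/-- The closed conditions that characterize the triples defined by a cut. -/
structure IsCut (T : Triples) : Prop where
  unique : ∀ x, ∃! j, T j x = true
  total : ∀ (x y : S) (i j : Fin 3), T i x = true → T j y = true → x ≠ y →
    Arc (rho i x) (rho j y) ∨ Arc (rho j y) (rho i x)
  trans : ∀ (x y z : S) (i j k : Fin 3), T i x = true → T j y = true → T k z = true →
    Arc (rho i x) (rho j y) → Arc (rho j y) (rho k z) → Arc (rho i x) (rho k z)

theorem isCut_tri (u : DoubledCircle) : IsCut (tri u) where
  unique := existsUnique_tri u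
  total := by
    intro x y i j hx hy hxy
    obtain ⟨p, hp, hp'⟩ := tri_eq_true.1 hx
    obtain ⟨q, hq, hq'⟩ := tri_eq_true.1 hy
    rw [hp', hq', arc_of_mem_sector hp hq, arc_of_mem_sector hq hp]
    refine lt_or_gt_of_ne ?_
    rintro rfl
    exact hxy (rho_inj_of_mem (hp'.trans hq'.symm)).2
  trans := by
    intro x y z i j k hx hy hz h1 h2
    obtain ⟨p, hp, hp'⟩ := tri_eq_true.1 hx
    obtain ⟨q, hq, hq'⟩ := tri_eq_true.1 hy
    obtain ⟨r, hr, hr'⟩ := tri_eq_true.1 hz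
    rw [hp', hq', arc_of_mem_sector hp hq] at h1
    rw [hq', hr', arc_of_mem_sector hq hr] at h2
    rw [hp', hr', arc_of_mem_sector hp hr]
    exact h1.trans h2

/-- Measured from one selected copy `a`, all selected copies have angles in a set `Δ`; the cut is
placed at its infimum. -/
theorem IsCut.exists_eq_tri {T : Triples} (hT : IsCut T) : ∃ u, T = tri u := by
  have h0 := third_pos
  let x₀ : S := ⟨Circle.exp ((0 : ℚ) : ℝ), 0, rfl⟩
  obtain ⟨j₀, hj₀, -⟩ := hT.unique x₀
  set a := rho j₀ x₀ with ha
  let Δ : Set ℝ := {δ | -third < δ ∧ δ < third ∧ ∃ j x, T j x = true ∧ rho j (x : S) = a * Circle.exp δ}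
  have hΔ : ∀ j x, T j x = true → ∃ δ ∈ Δ, rho j x = a * Circle.exp δ := by
    intro j x hx
    by_cases hxx : x = x₀
    · rw [hxx] at hx ⊢
      obtain rfl := (hT.unique x₀).unique hx hj₀
      exact ⟨0, ⟨by linarith, h0, j, x₀, hx, by simp [a]⟩, by simp [a]⟩
    rcases hT.total x x₀ j j₀ hx hj₀ hxx with h | h
    · obtain ⟨δ, hδ, h1⟩ := arc_iff.1 h
      have h2 : rho j x = a * Circle.exp (-δ) := by
        rw [ha, h1, mul_assoc, ← Circle.exp_add, add_neg_cancel, Circle.exp_zero, mul_one]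
      exact ⟨-δ, ⟨by linarith [hδ.2], by linarith [hδ.1], j, x, hx, h2⟩, h2⟩
    · obtain ⟨δ, hδ, h1⟩ := arc_iff.1 h
      exact ⟨δ, ⟨by linarith [hδ.1], hδ.2, j, x, hx, h1⟩, h1⟩
  -- If `p - q` were at least `third`, the points would lie on either side of `a`, and transitivity
  -- would give an arc of angle at least `third`.
  have hsub : ∀ p ∈ Δ, ∀ q ∈ Δ, p - q < third := by
    rintro p ⟨hp1, hp2, j, x, hx, hp⟩ q ⟨hq1, hq2, k, y, hy, hq⟩
    by_contra! hlt
    have hp0 : 0 < p := by linarith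
    have hq0 : q < 0 := by linarith
    have h1 : Arc a (rho j x) := arc_iff.2 ⟨p, ⟨hp0, hp2⟩, hp⟩
    have h2 : Arc (rho k y) a := arc_iff.2 ⟨-q, ⟨by linarith, by linarith⟩, by
      rw [hq, mul_assoc, ← Circle.exp_add, add_neg_cancel, Circle.exp_zero, mul_one]⟩
    have h3 := hT.trans y x₀ x k j₀ j hy hj₀ hx h2 h1
    rw [hp, hq, arc_mul_exp (by linarith) (by linarith)] at h3
    linarith [h3.2]
  have h0Δ : Δ.Nonempty := by
    obtain ⟨δ, hδ, -⟩ := hΔ j₀ x₀ hj₀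
    exact ⟨δ, hδ⟩
  have hbdd : BddBelow Δ := ⟨-third, fun δ hδ => hδ.1.le⟩
  set m := sInf Δ with hm
  have hmle : ∀ δ ∈ Δ, 0 ≤ δ - m := fun δ hδ => sub_nonneg.2 (csInf_le hbdd hδ)
  have hlem : ∀ δ ∈ Δ, δ - m ≤ third := fun δ hδ => by
    have : δ - third ≤ m := le_csInf h0Δ fun q hq => by linarith [hsub δ hδ q hq]
    linarith
  have hshift : ∀ δ, a * Circle.exp δ = a * Circle.exp m * Circle.exp (δ - m) := fun δ => by
    rw [mul_assoc, ← Circle.exp_add, add_sub_cancel]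
  have finish : ∀ u : DoubledCircle, u.proj = a * Circle.exp m → (∀ δ ∈ Δ, δ - m ∈ u.sector) →
      T = tri u := by
    intro u hu hu'
    funext j x
    refine eq_of_existsUnique (hT.unique x) (existsUnique_tri u x) (fun j hj => ?_) j
    obtain ⟨δ, hδ, h⟩ := hΔ j x hj
    exact tri_eq_true.2 ⟨δ - m, hu' δ hδ, by rw [h, hshift, hu]⟩
  -- At a doubled point, the selected copy of the corresponding `s` sits at one of the two ends of
  -- `[m, m + third]`, and by `hsub` the other end is never attained. This decides between `0` and
  -- `1`.
  by_cases ht : a * Circle.exp m ∈ doubledPts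
  · obtain ⟨s, k, hs⟩ := mem_doubledPts_iff.1 ht
    obtain ⟨j, hj, -⟩ := hT.unique s
    obtain ⟨δ, hδ, h⟩ := hΔ j s hj
    have h1 : rho (j - k) (a * Circle.exp m * Circle.exp 0) =
        rho 0 (a * Circle.exp m * Circle.exp (δ - m)) := by
      rw [← hshift, ← h, Circle.exp_zero, mul_one, hs, rho_rho, sub_add_cancel, rho_zero]
    rcases (hlem δ hδ).lt_or_eq with hlt | heq
    · have hmm : δ = m :=
        sub_eq_zero.1 (rho_mul_exp_inj (by linarith) (by linarith [hmle δ hδ]) h1).2.symm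
      refine ⟨double _ ht 0, finish _ rfl fun ε hε => ⟨hmle ε hε, ?_⟩⟩
      rw [← hmm]
      exact hsub _ hε _ hδ
    · refine ⟨double _ ht 1, finish _ rfl fun ε hε => ⟨?_, hlem ε hε⟩⟩
      linarith [hsub _ hδ _ hε]
  · refine ⟨single _ ht, finish _ rfl fun δ hδ => ⟨(hmle δ hδ).lt_of_ne ?_,
      (hlem δ hδ).lt_of_ne ?_⟩⟩
    · intro h
      obtain ⟨-, -, j, x, -, hx⟩ := hδ
      rw [hshift, ← h, Circle.exp_zero, mul_one] at hx
      exact ht (hx ▸ rho_coe_mem j x)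
    · intro h
      obtain ⟨-, -, j, x, -, hx⟩ := hδ
      rw [hshift, h] at hx
      exact ht (mul_exp_third_mem.1 (hx ▸ rho_coe_mem j x))

/-! ### Automorphisms of `S(3)` -/

/-- For `x ≠ y`, exactly one of the three copies of `y` receives an arc from `x`; `rho 1 y` is the
remaining case. Thus arcs between rotated copies are definable from the digraph, and automorphisms
preserve them. -/
theorem arc_rho_one_iff {x y : S} : Arc x (rho 1 y) ↔ x ≠ y ∧ ¬ Arc x y ∧ ¬ Arc y x := by
  rw [← arc_rho_two (x := x) (y := y)]
  have hu : ∀ {i j : Fin 3}, Arc x (rho i y) → Arc x (rho j y) → i = j := by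
    intro i j hi hj
    obtain ⟨p, hp, h1⟩ := arc_iff.1 hi
    obtain ⟨q, hq, h2⟩ := arc_iff.1 hj
    have h3 : rho (j - i) ((x : Circle) * Circle.exp p) = rho 0 ((x : Circle) * Circle.exp q) := by
      rw [← h1, ← h2, rho_rho, sub_add_cancel, rho_zero]
    exact (sub_eq_zero.1 (rho_mul_exp_inj (by linarith [hp.1, hq.2]) (by linarith [hp.2, hq.1])
      h3).1).symm
  constructor
  · intro h
    refine ⟨?_, fun h' => ?_, fun h' => ?_⟩
    · rintro rfl
      obtain ⟨p, hp, h1⟩ := arc_iff.1 h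
      have h2 : rho 1 ((x : Circle) * Circle.exp 0) = rho 0 ((x : Circle) * Circle.exp p) := by
        rw [rho_zero, ← h1, Circle.exp_zero, mul_one]
      exact absurd (rho_mul_exp_inj (by linarith [hp.2]) (by linarith [hp.1, third_pos]) h2).1
        (by decide)
    · rw [← rho_zero (y : Circle)] at h'
      exact absurd (hu h h') (by decide)
    · exact absurd (hu h h') (by decide)
  · rintro ⟨h1, h2, h3⟩
    obtain ⟨j, δ, hδ, h⟩ := exists_rho_Ico (x : Circle) (y : Circle)
    have h4 : Arc x (rho j y) := by
      refine arc_iff.2 ⟨δ, ⟨hδ.1.lt_of_ne ?_, hδ.2⟩, h⟩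
      rintro rfl
      rw [Circle.exp_zero, mul_one, ← rho_zero (x : Circle)] at h
      exact h1 (rho_inj_of_mem h).2.symm
    fin_cases j
    · exact absurd (by simpa using h4) h2
    · exact h4
    · exact absurd h4 h3

theorem arc_apply (g : AutS3) (x y : S) : Arc (g x) (g y) ↔ Arc x y := g.map_rel_iff

theorem arc_rho_apply (g : AutS3) (k : Fin 3) (x y : S) :
    Arc (g x) (rho k (g y)) ↔ Arc x (rho k y) := by
  fin_cases k
  · simpa using arc_apply g x y
  · change Arc (g x) (rho 1 (g y)) ↔ Arc x (rho 1 y)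
    rw [arc_rho_one_iff, arc_rho_one_iff, arc_apply, arc_apply, g.injective.ne_iff]
  · change Arc (g x) (rho 2 (g y)) ↔ Arc x (rho 2 y)
    rw [arc_rho_two, arc_rho_two, arc_apply]

theorem arc_rho_apply_rho (g : AutS3) (i j : Fin 3) (x y : S) :
    Arc (rho i (g x)) (rho j (g y)) ↔ Arc (rho i x) (rho j y) := by
  rw [arc_rho_rho, arc_rho_rho, arc_rho_apply]

theorem translate_apply (g : AutS3) (T : Triples) (j : Fin 3) (x : S) :
    translate g T j x = T j (g⁻¹ x) := rfl

theorem IsCut.translate {T : Triples} (hT : IsCut T) (g : AutS3) : IsCut (translate g T) where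
  unique x := hT.unique _
  total x y i j hx hy hxy := by
    have := hT.total _ _ i j hx hy (g⁻¹.injective.ne hxy)
    rwa [arc_rho_apply_rho, arc_rho_apply_rho] at this
  trans x y z i j k hx hy hz := by
    have := hT.trans _ _ _ i j k hx hy hz
    rwa [arc_rho_apply_rho, arc_rho_apply_rho, arc_rho_apply_rho] at this

theorem mem_orbitClosure_iff {T : Triples} :
    T ∈ orbitClosure ↔ ∀ F : Finset S, ∃ g : AutS3, ∀ x ∈ F, ∀ j, translate g sectors j x = T j x := by
  constructor
  · intro h F
    have hU : IsOpen {T' : Triples | ∀ x ∈ F, ∀ j, T' j x = T j x} := by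
      simp only [ofPred_forall]
      refine isOpen_biInter_finset fun x _ => isOpen_iInter_of_finite fun j => ?_
      exact (isOpen_discrete ({T j x} : Set Bool)).preimage
        ((continuous_apply x).comp (continuous_apply j) : Continuous fun T' : Triples => T' j x)
    obtain ⟨_, hg, g, rfl⟩ := mem_closure_iff.1 h _ hU fun x _ j => rfl
    exact ⟨g, hg⟩
  · intro h
    choose g hg using h
    refine mem_closure_of_tendsto (f := fun F => CircularDigraph.translate (g F) sectors)
      (b := Filter.atTop) ?_ (Filter.Eventually.of_forall fun F => ⟨g F, rfl⟩)
    refine tendsto_pi_nhds.2 fun j => tendsto_pi_nhds.2 fun x => ?_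
    refine tendsto_const_nhds.congr' ?_
    filter_upwards [Filter.eventually_ge_atTop {x}] with F hF
    exact (hg F x (hF (Finset.mem_singleton_self x)) j).symm

/-- The cut at which the sectors start. -/
noncomputable def startPt : Circle := Circle.exp (-(Real.pi / 6))

theorem startPt_notMem : startPt ∉ doubledPts := by
  intro h
  obtain ⟨⟨_, q, rfl⟩, j, hj⟩ := mem_doubledPts_iff.1 h
  unfold startPt rho at hj
  rw [← Circle.exp_add, exp_eq_exp_iff] at hj
  obtain ⟨m, hm⟩ := hj
  have h1 : Real.pi * (4 * ((j : ℕ) : ℤ) - 1 - 12 * m : ℤ) = 6 * q := by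
    unfold third at hm
    push_cast
    linear_combination 6 * hm
  -- The coefficient of `π` is `-1` modulo `4`, hence nonzero.
  have h2 : (4 * ((j : ℕ) : ℤ) - 1 - 12 * m : ℤ) ≠ 0 := by omega
  set k := (4 * ((j : ℕ) : ℤ) - 1 - 12 * m : ℤ)
  have hk : (k : ℝ) ≠ 0 := by exact_mod_cast h2
  refine irrational_pi ⟨6 * q / k, ?_⟩
  push_cast
  rw [← h1]
  field_simp

theorem sectors_eq : sectors = tri (single startPt startPt_notMem) := by
  funext j x
  rw [Bool.eq_iff_iff, tri_eq_true]
  simp only [sectors, decide_eq_true_eq]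
  constructor
  · rintro ⟨θ, hθ, h1, h2⟩
    refine ⟨θ + Real.pi / 6 - third * ((j : ℕ) : ℝ), ⟨?_, ?_⟩, ?_⟩
    · unfold third; linarith
    · unfold third; linarith
    · change _ = startPt * _
      rw [← hθ]
      unfold rho startPt
      rw [← Circle.exp_add, ← Circle.exp_add]
      congr 1
      ring
  · rintro ⟨δ, hδ, h⟩
    refine ⟨-(Real.pi / 6) + δ + third * ((j : ℕ) : ℝ), ?_, ?_, ?_⟩
    · change _ = startPt * _ at h
      apply rho_injective j
      rw [h]
      unfold rho startPt
      rw [← Circle.exp_add, ← Circle.exp_add]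
      congr 1
      ring
    · have := hδ.1; unfold third; linarith
    · have := hδ.2; unfold third at *; linarith

-- Each condition of `IsCut` concerns at most three points of `S`, so it can be checked on a
-- translate of the sectors agreeing with `T` there.
open Classical in
theorem isCut_of_mem_orbitClosure {T : Triples} (hT : T ∈ orbitClosure) : IsCut T := by
  have key : ∀ F : Finset S, ∃ T', IsCut T' ∧ ∀ x ∈ F, ∀ j, T' j x = T j x := by
    intro F
    obtain ⟨g, hg⟩ := mem_orbitClosure_iff.1 hT F
    exact ⟨_, (sectors_eq ▸ isCut_tri _ : IsCut sectors).translate g, hg⟩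
  refine ⟨fun x => ?_, fun x y i j hx hy => ?_, fun x y z i j k hx hy hz => ?_⟩
  · obtain ⟨T', hT', h⟩ := key {x}
    simpa only [h x (by simp)] using hT'.unique x
  · obtain ⟨T', hT', h⟩ := key ({x, y} : Finset S)
    exact hT'.total x y i j (by rw [h x (by simp), hx]) (by rw [h y (by simp), hy])
  · obtain ⟨T', hT', h⟩ := key ({x, y, z} : Finset S)
    exact hT'.trans x y z i j k (by rw [h x (by simp), hx]) (by rw [h y (by simp), hy])
      (by rw [h z (by simp), hz])

theorem exists_eq_tri_of_mem {T : Triples} (hT : T ∈ orbitClosure) : ∃ u, T = tri u :=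
  (isCut_of_mem_orbitClosure hT).exists_eq_tri

/-! ### Colours and positions of the points of `S` with respect to a cut -/

/-- The index of the set of the triple `tri u` to which `x` belongs. -/
noncomputable def colour (u : DoubledCircle) (x : S) : Fin 3 :=
  (exists_after (mem_doubledPts x) u).choose

theorem after_colour (u : DoubledCircle) (x : S) : After u (rho (colour u x) x) :=
  (exists_after (mem_doubledPts x) u).choose_spec

/-- The angular position of `x` after the cut `u`, modulo a third of a turn. -/
noncomputable def position (u : DoubledCircle) (x : S) : ℝ := (after_colour u x).choose

theorem position_mem (u : DoubledCircle) (x : S) : position u x ∈ u.sector :=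
  (after_colour u x).choose_spec.1

theorem rho_colour (u : DoubledCircle) (x : S) :
    rho (colour u x) x = u.proj * Circle.exp (position u x) :=
  (after_colour u x).choose_spec.2

theorem tri_eq_true_iff {j : Fin 3} {x : S} : tri u j x = true ↔ colour u x = j := by
  rw [tri_eq_true]
  exact ⟨eq_of_after (after_colour u x), fun h => h ▸ after_colour u x⟩

theorem colour_eq_iff {x y : S} :
    colour u x = colour v y ↔ ∀ j, tri u j x = tri v j y := by
  refine ⟨fun h j => ?_, fun h => ?_⟩
  · rw [Bool.eq_iff_iff, tri_eq_true_iff, tri_eq_true_iff, h]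
  · have := h (colour u x)
    rw [Bool.eq_iff_iff, tri_eq_true_iff, tri_eq_true_iff] at this
    exact (this.1 rfl).symm

theorem colour_eq_of_rho {j : Fin 3} {x : S} (hp : p ∈ u.sector)
    (h : rho j x = u.proj * Circle.exp p) : colour u x = j ∧ position u x = p := by
  have h1 := sub_lt_third u hp (position_mem u x)
  have h2 := sub_lt_third u (position_mem u x) hp
  have h3 : rho (j - colour u x) (u.proj * Circle.exp (position u x)) =
      rho 0 (u.proj * Circle.exp p) := by
    rw [← rho_colour, ← h, rho_rho, sub_add_cancel, rho_zero]
  obtain ⟨h4, h5⟩ := rho_mul_exp_inj (by linarith) h2 h3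
  exact ⟨(sub_eq_zero.1 h4).symm, h5⟩

/-- The order of two positions depends only on their colours and the digraph, not otherwise on the
cut. -/
theorem position_lt_iff {x y : S} :
    position u x < position u y ↔ Arc x (rho (colour u y - colour u x) y) := by
  rw [← arc_rho_rho, rho_colour, rho_colour, arc_of_mem_sector (position_mem u x)
    (position_mem u y)]

theorem position_injective (u : DoubledCircle) : Function.Injective (position u) := by
  intro x y h
  have := rho_colour u x
  rw [h, ← rho_colour] at this
  exact (rho_inj_of_mem this).2

/-- Both points are moved by the colour of `x`, and the cases are the three values of the colour
difference. This makes colour and order preserving bijections automorphisms. -/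
theorem arc_iff_position {x y : S} : Arc x y ↔
    (colour u x = colour u y ∧ position u x < position u y) ∨
      (colour u x = colour u y + 2 ∧ position u y < position u x) := by
  have h0 := third_pos
  have hx := position_mem u x
  have hy := position_mem u y
  have h1 : Arc x y ↔ Arc (rho (colour u x) x) (rho (colour u x - colour u y)
      (rho (colour u y) y)) := by
    rw [rho_rho, sub_add_cancel, arc_rho_rho, sub_self, rho_zero]
  rw [h1, rho_colour, rho_colour]
  obtain ⟨k, hk⟩ : ∃ k, colour u x = colour u y + k := ⟨colour u x - colour u y, by simp⟩
  rw [hk, add_sub_cancel_left, add_eq_left, add_right_inj]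
  fin_cases k
  · simpa using arc_of_mem_sector hx hy
  · have h2 := sub_lt_third u hy hx
    have h3 := sub_lt_third u hx hy
    simp only [Fin.mk_one, one_ne_zero, false_and, false_or, show ¬ ((1 : Fin 3) = 2) by decide,
      iff_false]
    rw [rho_mul_exp, arc_mul_exp (by simp; linarith) (by simp; linarith)]
    rintro ⟨h4, -⟩
    simp at h4
    linarith
  · simp only [Fin.reduceFinMk, arc_rho_two, arc_of_mem_sector hy hx]
    simp

theorem isDenseColouring (t : Circle) (ht : t ∉ doubledPts) :
    IsDenseColouring (colour (single t ht)) (position (single t ht)) third where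
  injective := position_injective _
  mem := position_mem (single t ht)
  dense := by
    intro j p q hp hpq hq
    obtain ⟨x, δ, h1, h2, h⟩ := exists_mem_rho_eq t j hpq
    obtain ⟨h3, h4⟩ := colour_eq_of_rho (u := single t ht) (p := δ)
      ⟨by linarith, by linarith⟩ h
    exact ⟨x, h3, by rwa [h4], by rwa [h4]⟩

theorem exists_aut_extending {t t' : Circle} (ht : t ∉ doubledPts) (ht' : t' ∉ doubledPts)
    {f : Finset (S × S)} (hf : IsPartialIso (colour (single t ht)) (position (single t ht))
      (colour (single t' ht')) (position (single t' ht')) f) :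
    ∃ g : AutS3, (∀ x, colour (single t' ht') (g x) = colour (single t ht) x) ∧
      ∀ p ∈ f, g p.1 = p.2 := by
  obtain ⟨e, h1, h2, h3⟩ := hf.exists_equiv (isDenseColouring t ht) (isDenseColouring t' ht')
    third_pos
  refine ⟨⟨e, ?_⟩, h1, h3⟩
  intro x y
  change Arc (e x) (e y) ↔ Arc x y
  rw [arc_iff_position (u := single t' ht'), arc_iff_position (u := single t ht), h1, h1, ← h2,
    ← h2]

theorem translate_tri_of_colour {g : AutS3} (h : ∀ x, colour v (g x) = colour u x) :
    translate g (tri u) = tri v := by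
  funext j x
  rw [translate_apply]
  refine colour_eq_iff.1 ?_ j
  rw [← h, RelIso.apply_inv_self]

theorem exists_pos_lt (F : Finset S) {f : S → ℝ} (h : ∀ x, 0 < f x) :
    ∃ η > 0, ∀ x ∈ F, η < f x := by
  classical
  induction F using Finset.induction_on with
  | empty => exact ⟨1, one_pos, by simp⟩
  | insert a F _ ih =>
    obtain ⟨η, hη, hF⟩ := ih
    obtain ⟨η', h1, h2⟩ := exists_between (lt_min hη (h a))
    refine ⟨η', h1, fun x hx => ?_⟩
    rcases Finset.mem_insert.1 hx with rfl | hx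
    · exact h2.trans_le (min_le_right _ _)
    · exact (h2.trans_le (min_le_left _ _)).trans (hF x hx)

/-- On a finite set, the triple of a cut agrees with the triple of a cut at an undoubled point. -/
theorem exists_single_agree (u : DoubledCircle) (F : Finset S) :
    ∃ t ht, ∀ x ∈ F, colour (single t ht) x = colour u x := by
  have key : ∀ ε, u.proj * Circle.exp ε ∉ doubledPts →
      (∀ x ∈ F, position u x - ε ∈ Ioo 0 third) →
      ∃ t ht, ∀ x ∈ F, colour (single t ht) x = colour u x := by
    refine fun ε ht h => ⟨_, ht, fun x hx => (colour_eq_of_rho (u := single _ ht)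
      (p := position u x - ε) (h x hx) ?_).1⟩
    rw [rho_colour]
    change _ = u.proj * Circle.exp ε * _
    rw [mul_assoc, ← Circle.exp_add, add_sub_cancel]
  induction u using DoubledCircle.forall_of with
  | h t ht => exact ⟨t, ht, fun _ _ => rfl⟩
  | h0 t ht =>
    have hpos : ∀ x, position (double t ht 0) x ∈ Ico 0 third := position_mem (double t ht 0)
    -- The sector of `(t, 0)` contains its start but not its end, so there is room to move the cut
    -- slightly backwards; for `(t, 1)` it is moved forwards.
    obtain ⟨η, hη, hF⟩ := exists_pos_lt F
      (f := fun x => third - position (double t ht 0) x) fun x => sub_pos.2 (hpos x).2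
    obtain ⟨ε, h1, h2, h3⟩ := exists_notMem_doubledPts t (neg_lt_zero.2 hη)
    exact key ε h3 fun x hx => ⟨by linarith [(hpos x).1], by linarith [hF x hx]⟩
  | h1 t ht =>
    have hpos : ∀ x, position (double t ht 1) x ∈ Ioc 0 third := position_mem (double t ht 1)
    obtain ⟨η, hη, hF⟩ := exists_pos_lt F
      (f := fun x => position (double t ht 1) x) fun x => (hpos x).1
    obtain ⟨ε, h1, h2, h3⟩ := exists_notMem_doubledPts t hη
    exact key ε h3 fun x hx => ⟨by linarith [hF x hx], by linarith [(hpos x).2]⟩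

/-- With the empty partial map, back and forth carries the starting cut to any undoubled cut. -/
theorem tri_mem_orbitClosure (u : DoubledCircle) : tri u ∈ orbitClosure := by
  rw [mem_orbitClosure_iff]
  intro F
  obtain ⟨t, ht, h⟩ := exists_single_agree u F
  obtain ⟨g, hg, -⟩ := exists_aut_extending startPt_notMem ht (f := ∅)
    fun p hp => absurd hp (Finset.notMem_empty p)
  refine ⟨g, fun x hx j => ?_⟩
  rw [sectors_eq, translate_tri_of_colour hg]
  exact colour_eq_iff.1 (h x hx) j

/-! ### The coding map -/

theorem after_proj_iff : After u u.proj ↔ (0 : ℝ) ∈ u.sector := by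
  constructor
  · rintro ⟨δ, hδ, h⟩
    have h1 := sector_subset u hδ
    rw [left_eq_mul, ← Circle.exp_zero, exp_eq_exp_iff] at h
    obtain ⟨m, hm⟩ := h
    have h2 : ((3 * m : ℤ) : ℝ) < 2 := by
      push_cast
      by_contra! hh
      nlinarith [third_pos, h1.2]
    have h3 : -1 < ((3 * m : ℤ) : ℝ) := by
      push_cast
      by_contra! hh
      nlinarith [third_pos, h1.1]
    have h4 : 3 * m < 2 := by exact_mod_cast h2
    have h5 : -1 < 3 * m := by exact_mod_cast h3
    obtain rfl : m = 0 := by omega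
    simp at hm
    exact hm ▸ hδ
  · intro h
    exact ⟨0, h, by simp⟩

theorem rho_two_eq (t : Circle) : rho 2 t = t * Circle.exp third := by
  unfold rho
  rw [mul_right_inj, exp_eq_exp_iff]
  refine ⟨-1, ?_⟩
  simp
  ring

theorem after_rho_two_proj_iff : After u (rho 2 u.proj) ↔ third ∈ u.sector := by
  constructor
  · rintro ⟨δ, hδ, h⟩
    have h0 := third_pos
    have h1 := sector_subset u hδ
    rw [rho_two_eq, mul_right_inj, exp_eq_exp_iff] at h
    obtain ⟨m, hm⟩ := h
    have h2 : ((3 * m : ℤ) : ℝ) < 2 := by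
      push_cast
      by_contra! hh
      nlinarith [h1.1]
    have h3 : -1 < ((3 * m : ℤ) : ℝ) := by
      push_cast
      by_contra! hh
      nlinarith [h1.2]
    have h4 : 3 * m < 2 := by exact_mod_cast h2
    have h5 : -1 < 3 * m := by exact_mod_cast h3
    obtain rfl : m = 0 := by omega
    simp at hm
    exact hm ▸ hδ
  · intro h
    exact ⟨third, h, rho_two_eq _⟩

theorem eq_double_zero {t : Circle} (h : t = u.proj) (ht : t ∈ doubledPts)
    (h0 : (0 : ℝ) ∈ u.sector) : double t ht 0 = u := by
  subst h
  induction u using DoubledCircle.forall_of with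
  | h t ht' => exact absurd ht ht'
  | h0 t ht => rfl
  | h1 t ht => exact absurd h0.1 (lt_irrefl _)

theorem eq_double_one {t : Circle} (h : t = u.proj) (ht : t ∈ doubledPts)
    (h0 : third ∈ u.sector) : double t ht 1 = u := by
  subst h
  induction u using DoubledCircle.forall_of with
  | h t ht' => exact absurd ht ht'
  | h0 t ht => exact absurd h0.2 (lt_irrefl _)
  | h1 t ht => rfl

theorem supFirst_tri (u : DoubledCircle) : SupFirst (tri u) u.proj := by
  constructor
  · rintro _ ⟨x, hx, rfl⟩ h
    rw [tri_eq_true, rho_zero] at hx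
    obtain ⟨δ, hδ, hx⟩ := hx
    have h1 := sector_subset u hδ
    have h2 := arc_mul_exp (t := u.proj) (a := δ) (b := 0) (by linarith [h1.2, third_pos])
      (by linarith [h1.1, third_pos])
    rw [hx, ← mul_one u.proj, mul_assoc, one_mul, ← Circle.exp_zero, h2] at h
    linarith [h.1, h1.1]
  · intro s hs
    obtain ⟨δ, hδ, rfl⟩ := arc_iff.1 hs
    obtain ⟨x, ε, h1, h2, h⟩ := exists_mem_rho_eq u.proj 0 hδ.1
    have hx : After u (rho 0 x) := ⟨ε, subset_sector u ⟨h1, h2.trans hδ.2⟩, h⟩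
    refine ⟨x, ⟨x, tri_eq_true.2 hx, rfl⟩, ?_⟩
    rw [rho_zero] at h
    rw [h, arc_mul_exp (by linarith [hδ.1, hδ.2, third_pos]) (by linarith [hδ.2, third_pos])]
    exact ⟨by linarith, by linarith [hδ.2]⟩

theorem eq_proj_of_supFirst {t : Circle} (h : SupFirst (tri u) t) : t = u.proj := by
  have h0 := third_pos
  by_contra hne
  obtain ⟨δ, h1, h2, h3⟩ : ∃ δ, 0 < δ ∧ δ < 3 * third ∧ t = u.proj * Circle.exp δ := by
    obtain ⟨δ, hδ⟩ := Circle.exp_surjective (t / u.proj)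
    obtain ⟨m, hm, -⟩ := existsUnique_add_zsmul_mem_Ico
      (show (0 : ℝ) < 3 * third by linarith) δ 0
    have h3 : t = u.proj * Circle.exp (δ + m • (3 * third)) := by
      rw [← mul_div_cancel u.proj t, ← hδ, mul_right_inj, exp_eq_exp_iff]
      refine ⟨-m, ?_⟩
      rw [zsmul_eq_mul]
      push_cast
      ring
    refine ⟨_, hm.1.lt_of_ne fun h => hne ?_, by linarith [hm.2], h3⟩
    rw [h3, ← h, Circle.exp_zero, mul_one]
  subst h3
  obtain ⟨ha, hb⟩ := h
  -- Below `2 * third`, some point of the first set has an arc to `t`, so `t` is too small to be an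
  -- upper bound. Otherwise points slightly beyond `t` are out of reach of the first set.
  by_cases h4 : δ < 2 * third
  · obtain ⟨x, ε, hε1, hε2, hx⟩ := exists_mem_rho_eq u.proj 0
      (show max 0 (δ - third) < min δ third from
        max_lt (lt_min h1 h0) (lt_min (by linarith) (by linarith)))
    obtain ⟨hε1, hε1'⟩ := max_lt_iff.1 hε1
    obtain ⟨hε2, hε2'⟩ := lt_min_iff.1 hε2
    refine ha x ⟨x, tri_eq_true.2 ⟨ε, subset_sector u ⟨hε1, hε2'⟩, hx⟩, rfl⟩ ?_
    rw [rho_zero] at hx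
    rw [hx, arc_mul_exp (by linarith) (by linarith)]
    exact ⟨by linarith, by linarith⟩
  · obtain ⟨η, hη1, hη2⟩ := exists_between h2
    obtain ⟨_, ⟨x, hx, rfl⟩, hxs⟩ := hb (u.proj * Circle.exp η) (by
      rw [arc_mul_exp (by linarith) (by linarith)]
      exact ⟨by linarith, by linarith⟩)
    obtain ⟨ε, hε, hx⟩ := tri_eq_true.1 hx
    have hε' := sector_subset u hε
    rw [rho_zero] at hx
    rw [hx, arc_mul_exp (by linarith [hε'.2]) (by linarith [hε'.1])] at hxs
    linarith [hxs.2, hε'.2]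

/-- If `rho i s` is the projection of `u`, the copy of `s` in the sector is `rho i s` when the
sector contains its start and `rho (2 + i) s` when it contains its end. This is the table in
`Codes`. -/
theorem codes_tri (u : DoubledCircle) : Codes (tri u) u := by
  have key : ∀ {i j : Fin 3} {s : S} {t : Circle}, t = rho i s → u.proj = t →
      (((0 : ℝ) ∈ u.sector → i = j → tri u j s = true) ∧
        (third ∈ u.sector → i = 2 + j → tri u (2 + i) s = true)) := by
    intro i j s t h h'
    refine ⟨fun h1 h2 => ?_, fun h1 h2 => ?_⟩
    · rw [tri_eq_true, ← h2, ← h, ← h', after_proj_iff]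
      exact h1
    · rw [tri_eq_true, ← rho_rho, ← h, ← h', after_rho_two_proj_iff]
      exact h1
  have hsup := supFirst_tri u
  rcases u with ⟨t, ht⟩ | ⟨t, ht, i⟩
  · exact Codes.single t ht hsup
  · have h0 := third_pos
    rcases id ht with (h | ⟨s, hs, rfl⟩) | ⟨s, hs, rfl⟩ <;> fin_cases i
    · exact Codes.zero ⟨t, h⟩ hsup
        ((key (i := 0) (j := 0) (s := ⟨t, h⟩) (rho_zero t).symm rfl).1 ⟨le_rfl, h0⟩ rfl)
    · exact Codes.one ⟨t, h⟩ hsup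
        ((key (i := 0) (j := 1) (s := ⟨t, h⟩) (rho_zero t).symm rfl).2 ⟨h0, le_rfl⟩ rfl)
    · exact Codes.rot_zero ⟨s, hs⟩ hsup
        ((key (i := 1) (j := 1) (s := ⟨s, hs⟩) (rot_eq s) rfl).1 ⟨le_rfl, h0⟩ rfl)
    · exact Codes.rot_one ⟨s, hs⟩ hsup
        ((key (i := 1) (j := 2) (s := ⟨s, hs⟩) (rot_eq s) rfl).2 ⟨h0, le_rfl⟩ rfl)
    · exact Codes.rot_symm_zero ⟨s, hs⟩ hsup
        ((key (i := 2) (j := 2) (s := ⟨s, hs⟩) (rot_symm_eq s) rfl).1 ⟨le_rfl, h0⟩ rfl)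
    · exact Codes.rot_symm_one ⟨s, hs⟩ hsup
        ((key (i := 2) (j := 0) (s := ⟨s, hs⟩) (rot_symm_eq s) rfl).2 ⟨h0, le_rfl⟩ rfl)

theorem eq_of_codes_tri (h : Codes (tri u) v) : v = u := by
  have key0 : ∀ {i : Fin 3} {s : S} {t : Circle} (ht : t ∈ doubledPts), t = rho i s →
      t = u.proj → tri u i s = true → double t ht 0 = u := by
    intro i s t ht h1 h2 h3
    refine eq_double_zero h2 ht (after_proj_iff.1 ?_)
    rw [← h2, h1]
    exact tri_eq_true.1 h3
  have key1 : ∀ {i j : Fin 3} {s : S} {t : Circle} (ht : t ∈ doubledPts), t = rho i s →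
      t = u.proj → tri u j s = true → j = 2 + i → double t ht 1 = u := by
    intro i j s t ht h1 h2 h3 h4
    refine eq_double_one h2 ht (after_rho_two_proj_iff.1 ?_)
    rw [← h2, h1, rho_rho, ← h4]
    exact tri_eq_true.1 h3
  cases h with
  | single t ht h =>
    obtain rfl := eq_proj_of_supFirst h
    rcases u with ⟨t, ht'⟩ | ⟨t, ht', i⟩
    · rfl
    · exact absurd ht' ht
  | zero s h hs => exact key0 _ (rho_zero (s : Circle)).symm (eq_proj_of_supFirst h) hs
  | one s h hs => exact key1 _ (rho_zero (s : Circle)).symm (eq_proj_of_supFirst h) hs rfl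
  | rot_zero s h hs => exact key0 _ (rot_eq s) (eq_proj_of_supFirst h) hs
  | rot_one s h hs => exact key1 _ (rot_eq s) (eq_proj_of_supFirst h) hs rfl
  | rot_symm_zero s h hs => exact key0 _ (rot_symm_eq s) (eq_proj_of_supFirst h) hs
  | rot_symm_one s h hs => exact key1 _ (rot_symm_eq s) (eq_proj_of_supFirst h) hs rfl

/-! ### The topology of the circle with doubled points -/

theorem after_single_iff {t a : Circle} (ht : t ∉ doubledPts) :
    After (single t ht) a ↔ Arc t a := arc_iff.symm

theorem after_zero_iff {t a : Circle} (ht : t ∈ doubledPts) :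
    After (double t ht 0) a ↔ a = t ∨ Arc t a := by
  rw [arc_iff]
  constructor
  · rintro ⟨δ, hδ, rfl⟩
    rcases hδ.1.eq_or_lt with rfl | h
    · exact Or.inl (by simp [proj])
    · exact Or.inr ⟨δ, ⟨h, hδ.2⟩, rfl⟩
  · rintro (rfl | ⟨δ, hδ, rfl⟩)
    · exact ⟨0, ⟨le_rfl, third_pos⟩, by simp [proj]⟩
    · exact ⟨δ, ⟨hδ.1.le, hδ.2⟩, rfl⟩

theorem after_one_iff {t a : Circle} (ht : t ∈ doubledPts) :
    After (double t ht 1) a ↔ a = rot.symm t ∨ Arc t a := by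
  rw [arc_iff, rot_symm_eq, rho_two_eq]
  constructor
  · rintro ⟨δ, hδ, rfl⟩
    rcases hδ.2.eq_or_lt with rfl | h
    · exact Or.inl rfl
    · exact Or.inr ⟨δ, ⟨hδ.1, h⟩, rfl⟩
  · rintro (rfl | ⟨δ, hδ, rfl⟩)
    · exact ⟨third, ⟨third_pos, le_rfl⟩, rfl⟩
    · exact ⟨δ, ⟨hδ.1, hδ.2.le⟩, rfl⟩

/-- By `arc_rot`, an arc from `β` to a point is an arc from that point to `rot.symm β`. The
hypothesis `h` puts the two doubled ends in the set and excludes the other half of each. -/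
theorem interval_eq {α β : Circle} (hα : α ∈ doubledPts) (hβ : β ∈ doubledPts) (h : Arc β α) :
    interval α β hα hβ = {u | After u α ∧ After u (rot.symm β)} := by
  ext u
  simp only [interval, mem_union, mem_singleton_iff, mem_ofPred_eq]
  induction u using DoubledCircle.forall_of with
  | h t ht =>
    rw [after_single_iff, after_single_iff, arc_rot]
    simp [proj]
  | h0 t ht =>
    rw [after_zero_iff, after_zero_iff, arc_rot]
    simp only [double.injEq, proj, and_true, show ¬ ((0 : Fin 2) = 1) by decide, and_false,
      or_false]
    constructor
    · rintro (rfl | ⟨h1, h2⟩)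
      · exact ⟨Or.inl rfl, Or.inr h⟩
      · exact ⟨Or.inr h1, Or.inr h2⟩
    · rintro ⟨rfl | h1, h2 | h2⟩
      · exact Or.inl rfl
      · exact Or.inl rfl
      · rw [← h2] at h1
        exact absurd (arc_rot.2 h) (arc_asymm h1)
      · exact Or.inr ⟨h1, h2⟩
  | h1 t ht =>
    rw [after_one_iff, after_one_iff, arc_rot]
    simp only [double.injEq, proj, and_true, show ¬ ((1 : Fin 2) = 0) by decide, and_false,
      false_or, rot.symm.injective.eq_iff]
    constructor
    · rintro (⟨h1, h2⟩ | rfl)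
      · exact ⟨Or.inr h1, Or.inr h2⟩
      · exact ⟨Or.inr h, Or.inl rfl⟩
    · rintro ⟨h1 | h1, h2 | h2⟩
      · exact Or.inr h2.symm
      · rw [h1, arc_rot] at h
        exact absurd h2 (arc_asymm h)
      · exact Or.inr h2.symm
      · exact Or.inl ⟨h1, h2⟩

theorem mem_intervals_of_arc {α γ : Circle} (hα : α ∈ doubledPts) (hγ : γ ∈ doubledPts)
    (h : Arc α γ) : {u | After u α ∧ After u γ} ∈ intervals := by
  have hβ : rot γ ∈ doubledPts := by rw [rot_eq]; exact (rho_mem_doubledPts 1).2 hγ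
  have h' : Arc (rot γ) α := by rwa [← arc_rot, Equiv.symm_apply_apply]
  refine ⟨α, rot γ, hα, hβ, h', ?_⟩
  rw [interval_eq hα hβ h', Equiv.symm_apply_apply]

theorem exists_of_mem_intervals {U : Set DoubledCircle} (hU : U ∈ intervals) :
    ∃ α ∈ doubledPts, ∃ γ ∈ doubledPts, Arc α γ ∧ U = {u | After u α ∧ After u γ} := by
  obtain ⟨α, β, hα, hβ, h, rfl⟩ := hU
  refine ⟨α, hα, rot.symm β, ?_, arc_rot.2 h, interval_eq hα hβ h⟩
  rw [rot_symm_eq]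
  exact (rho_mem_doubledPts 2).2 hβ

theorem exists_mem_doubledPts (t : Circle) (h : p < q) :
    ∃ δ, p < δ ∧ δ < q ∧ t * Circle.exp δ ∈ doubledPts := by
  obtain ⟨x, δ, h1, h2, hx⟩ := exists_mem_rho_eq t 0 h
  exact ⟨δ, h1, h2, hx ▸ rho_coe_mem 0 x⟩

/-- An auxiliary doubled point in the same sector, after `α` or, when `α` is at its end, before it,
gives a basic interval around `u`. -/
theorem isOpen_after {α : Circle} (hα : α ∈ doubledPts) : IsOpen {u | After u α} := by
  rw [isOpen_iff_forall_mem_open]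
  rintro u ⟨p, hp, rfl⟩
  have h0 := third_pos
  have hp' := sector_subset u hp
  by_cases hlt : p < third
  · obtain ⟨δ, h1, h2, h⟩ := exists_mem_doubledPts u.proj hlt
    have hδ : δ ∈ u.sector := subset_sector u ⟨hp'.1.trans_lt h1, h2⟩
    exact ⟨_, fun v hv => hv.1, TopologicalSpace.isOpen_generateFrom_of_mem
      (mem_intervals_of_arc hα h ((arc_of_mem_sector hp hδ).2 h1)),
      after_mul_exp hp, after_mul_exp hδ⟩
  · obtain ⟨δ, h1, h2, h⟩ := exists_mem_doubledPts u.proj h0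
    have hδ : δ ∈ u.sector := subset_sector u ⟨h1, h2⟩
    exact ⟨_, fun v hv => hv.2, TopologicalSpace.isOpen_generateFrom_of_mem
      (mem_intervals_of_arc h hα ((arc_of_mem_sector hδ hp).2 (by linarith))),
      after_mul_exp hδ, after_mul_exp hp⟩

theorem isTopologicalBasis_intervals : TopologicalSpace.IsTopologicalBasis intervals where
  exists_subset_inter := by
    intro U hU V hV u hu
    obtain ⟨α, hα, γ, hγ, h1, rfl⟩ := exists_of_mem_intervals hU
    obtain ⟨α', hα', γ', hγ', h2, rfl⟩ := exists_of_mem_intervals hV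
    obtain ⟨⟨⟨p, hp, rfl⟩, q, hq, rfl⟩, ⟨p', hp', rfl⟩, q', hq', rfl⟩ := hu
    rw [arc_of_mem_sector hp hq] at h1
    rw [arc_of_mem_sector hp' hq'] at h2
    -- Requiring the outermost of the four points to follow the cut forces all four to do so, by
    -- convexity.
    have hmin : min p p' ∈ u.sector ∧ u.proj * Circle.exp (min p p') ∈ doubledPts := by
      rcases min_choice p p' with h | h <;> rw [h] <;> constructor <;> assumption
    have hmax : max q q' ∈ u.sector ∧ u.proj * Circle.exp (max q q') ∈ doubledPts := by
      rcases max_choice q q' with h | h <;> rw [h] <;> constructor <;> assumption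
    refine ⟨_, mem_intervals_of_arc hmin.2 hmax.2 ((arc_of_mem_sector hmin.1 hmax.1).2
      ((min_le_left _ _).trans_lt (h1.trans_le (le_max_left _ _)))),
      ⟨after_mul_exp hmin.1, after_mul_exp hmax.1⟩, ?_⟩
    rintro v ⟨hv1, hv2⟩
    have key : ∀ r, min p p' ≤ r → r ≤ max q q' → After v (u.proj * Circle.exp r) := fun r h h' =>
      after_of_between hmin.1 hmax.1 h h' hv1 hv2
    exact ⟨⟨key _ (min_le_left _ _) (h1.le.trans (le_max_left _ _)),
      key _ ((min_le_left _ _).trans h1.le) (le_max_left _ _)⟩,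
      key _ (min_le_right _ _) (h2.le.trans (le_max_right _ _)),
      key _ ((min_le_right _ _).trans h2.le) (le_max_right _ _)⟩
  sUnion_eq := by
    refine eq_univ_of_forall fun u => ?_
    obtain ⟨p, hp1, hp2, hp⟩ := exists_mem_doubledPts u.proj third_pos
    obtain ⟨q, hq1, hq2, hq⟩ := exists_mem_doubledPts u.proj hp2
    have hp' := subset_sector u ⟨hp1, hp2⟩
    have hq' := subset_sector u ⟨hp1.trans hq1, hq2⟩
    exact ⟨_, mem_intervals_of_arc hp hq ((arc_of_mem_sector hp' hq').2 hq1),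
      after_mul_exp hp', after_mul_exp hq'⟩
  eq_generateFrom := rfl

/-- The three copies of `x` give a partition of the doubled circle into three open sets. -/
theorem isClopen_after (j : Fin 3) (x : S) : IsClopen {u | After u (rho j x)} := by
  refine ⟨⟨?_⟩, isOpen_after (rho_coe_mem j x)⟩
  have : {u | After u (rho j x)}ᶜ = ⋃ i ∈ {i | i ≠ j}, {u | After u (rho i x)} := by
    ext u
    simp only [mem_compl_iff, mem_ofPred_eq, mem_iUnion, exists_prop]
    constructor
    · intro h
      obtain ⟨i, hi⟩ := exists_after (mem_doubledPts x) u
      exact ⟨i, fun hij => h (hij ▸ hi), hi⟩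
    · rintro ⟨i, hij, hi⟩ hj
      exact hij (eq_of_after hi hj)
  rw [this]
  exact isOpen_biUnion fun i _ => isOpen_after (rho_coe_mem i x)

theorem continuous_tri : Continuous tri := by
  refine continuous_pi fun j => continuous_pi fun x => ?_
  refine (continuous_boolIndicator_iff_isClopen _).2 (isClopen_after j x) |>.congr fun u => ?_
  rw [Bool.eq_iff_iff, tri_eq_true, ← Set.mem_iff_boolIndicator]
  rfl

theorem tri_injective : Function.Injective tri := fun u v h =>
  eq_of_codes_tri (u := v) (h ▸ codes_tri u)

/-- The correspondence between cuts and triples in `X*`. -/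
noncomputable def cutEquiv : DoubledCircle ≃ orbitClosure :=
  Equiv.ofBijective (fun u => (⟨tri u, tri_mem_orbitClosure u⟩ : orbitClosure))
    ⟨fun _ _ h => tri_injective (congrArg Subtype.val h), fun T =>
      let ⟨u, hu⟩ := exists_eq_tri_of_mem T.2
      ⟨u, Subtype.ext hu.symm⟩⟩

/-- The homeomorphism between `X*` and the circle with doubled points. -/
noncomputable def coding : orbitClosure ≃ₜ DoubledCircle := Homeomorph.symm
  { cutEquiv with
    continuous_toFun := continuous_tri.subtype_mk _
    continuous_invFun := by
      refine continuous_generateFrom_iff.2 fun U hU => ?_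
      obtain ⟨α, hα, γ, hγ, -, rfl⟩ := exists_of_mem_intervals hU
      obtain ⟨x, i, rfl⟩ := mem_doubledPts_iff.1 hα
      obtain ⟨y, j, rfl⟩ := mem_doubledPts_iff.1 hγ
      have : ∀ (k : Fin 3) (z : S), IsOpen {T : orbitClosure | (T : Triples) k z = true} :=
        fun k z => (isOpen_discrete ({true} : Set Bool)).preimage
          (((continuous_apply z).comp (continuous_apply k) : Continuous fun T : Triples =>
            T k z).comp continuous_subtype_val)
      convert (this i x).inter (this j y) using 1
      ext T
      obtain ⟨u, rfl⟩ := cutEquiv.surjective T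
      change After (cutEquiv.symm (cutEquiv u)) _ ∧ After (cutEquiv.symm (cutEquiv u)) _ ↔
        tri u i x = true ∧ tri u j y = true
      rw [Equiv.symm_apply_apply, tri_eq_true, tri_eq_true] }

theorem coding_symm_apply (u : DoubledCircle) : (coding.symm u : Triples) = tri u := rfl

theorem coding_eq_iff (T : orbitClosure) (x : DoubledCircle) : coding T = x ↔ Codes T x := by
  obtain ⟨u, rfl⟩ := coding.symm.surjective T
  rw [Homeomorph.apply_symm_apply, coding_symm_apply]
  exact ⟨fun h => h ▸ codes_tri u, fun h => (eq_of_codes_tri h).symm⟩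

end CircularDigraph

/-- Ramsey's theorem for increasing maps from a finite set of reals to `ℕ`. -/
theorem exists_strictMono_monochromatic_of_injective {F κ : Type*} [Fintype F] [Finite κ]
    {pos : F → ℝ} (hpos : Function.Injective pos) (χ : (F → ℕ) → κ) :
    ∃ H : ℕ → ℕ, StrictMono H ∧ ∃ col, ∀ f : F → ℕ, (∀ x y, pos x < pos y → f x < f y) →
      χ (H ∘ f) = col := by
  let : LinearOrder F := LinearOrder.lift' pos hpos
  let e : Fin (Fintype.card F) ≃o F := Fintype.orderIsoFinOfCardEq F rfl
  obtain ⟨H, hH, col, hcol⟩ := exists_strictMono_monochromatic (Fintype.card F)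
    fun f => χ (f ∘ e.symm)
  refine ⟨H, hH, col, fun f hf => ?_⟩
  rw [← hcol (f ∘ e) fun i j hij => hf _ _ (e.strictMono hij)]
  congr 1
  funext x
  simp

namespace CircularDigraph

open DoubledCircle Topology Uniformity

variable {u v : DoubledCircle}

/-! ### The flow on `X*` -/

theorem eventually_apply_eq (g : AutS3) (x : S) : ∀ᶠ h in 𝓝 g, h x = g x :=
  (isOpen_apply_eq x (g x)).mem_nhds rfl

theorem position_lt_apply_iff {g : AutS3} {x y : S} (hx : colour v (g x) = colour u x)
    (hy : colour v (g y) = colour u y) :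
    position v (g x) < position v (g y) ↔ position u x < position u y := by
  rw [position_lt_iff, position_lt_iff, hx, hy, arc_rho_apply]

theorem position_lt_congr {x y : S} (hx : colour v x = colour u x)
    (hy : colour v y = colour u y) : position v x < position v y ↔ position u x < position u y := by
  rw [position_lt_iff, position_lt_iff, hx, hy]

instance : ContinuousSMul AutS3 orbitClosure where
  continuous_smul := by
    refine Continuous.subtype_mk (f := fun p : AutS3 × orbitClosure =>
      translate p.1 (p.2 : Triples)) ?_ fun p => (p.1 • p.2).2
    refine continuous_pi fun j => continuous_pi fun x => continuous_iff_continuousAt.2 ?_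
    rintro ⟨g, T⟩
    have h1 : ContinuousAt (fun p : AutS3 × orbitClosure => (p.2 : Triples) j (g⁻¹ x)) (g, T) :=
      (((continuous_apply (g⁻¹ x)).comp (continuous_apply j) :
        Continuous fun T : Triples => T j (g⁻¹ x)).comp
          (continuous_subtype_val.comp continuous_snd)).continuousAt
    refine h1.congr ?_
    have h2 : ∀ᶠ p : AutS3 × orbitClosure in 𝓝 (g, T), p.1⁻¹ x = g⁻¹ x :=
      ((continuous_fst.inv).continuousAt (x := (g, T))).eventually (eventually_apply_eq g⁻¹ x)
    filter_upwards [h2] with p hp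
    rw [translate_apply, hp]

instance : CompactSpace orbitClosure := isCompact_iff_compactSpace.1 isClosed_closure.isCompact

/-- A basic neighbourhood prescribes the colours of two points `x` and `y`. Points `a` and `b` with
the same colours and order exist after any cut, and some automorphism sends them to `x` and `y`; it
need not send one cut to the other. -/
theorem closure_orbit_eq_univ (T : orbitClosure) :
    closure (MulAction.orbit AutS3 T) = univ := by
  classical
  refine dense_iff_closure_eq.1 (dense_iff_inter_open.2 fun V hV ⟨T', hT'⟩ => ?_)
  obtain ⟨u, rfl⟩ := coding.symm.surjective T
  obtain ⟨u', rfl⟩ := coding.symm.surjective T'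
  obtain ⟨I, hI, hu', hIV⟩ := isTopologicalBasis_intervals.mem_nhds_iff.1
    ((hV.preimage coding.symm.continuous).mem_nhds hT')
  obtain ⟨α, hα, γ, hγ, hαγ, rfl⟩ := exists_of_mem_intervals hI
  obtain ⟨x, i, rfl⟩ := mem_doubledPts_iff.1 hα
  obtain ⟨y, j, rfl⟩ := mem_doubledPts_iff.1 hγ
  have hx' : colour u' x = i := tri_eq_true_iff.1 (tri_eq_true.2 hu'.1)
  have hy' : colour u' y = j := tri_eq_true_iff.1 (tri_eq_true.2 hu'.2)
  have hxy : position u' x < position u' y := by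
    rwa [position_lt_iff, hx', hy', ← arc_rho_rho]
  have h0 := third_pos
  obtain ⟨a, δ, hδ1, hδ2, ha⟩ := exists_mem_rho_eq u.proj i h0
  obtain ⟨b, ε, hε1, hε2, hb⟩ := exists_mem_rho_eq u.proj j hδ2
  obtain ⟨hca, hpa⟩ := colour_eq_of_rho (subset_sector u ⟨hδ1, hδ2⟩) ha
  obtain ⟨hcb, hpb⟩ := colour_eq_of_rho (subset_sector u ⟨hδ1.trans hε1, hε2⟩) hb
  obtain ⟨t, ht, htF⟩ := exists_single_agree u {a, b}
  obtain ⟨t', ht', htF'⟩ := exists_single_agree u' {x, y}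
  have h1 : position (single t ht) a < position (single t ht) b := by
    rw [position_lt_congr (htF a (by simp)) (htF b (by simp)), hpa, hpb]
    exact hε1
  have h2 : position (single t' ht') x < position (single t' ht') y := by
    rwa [position_lt_congr (htF' x (by simp)) (htF' y (by simp))]
  have hiso : IsPartialIso (colour (single t ht)) (position (single t ht))
      (colour (single t' ht')) (position (single t' ht')) {(a, x), (b, y)} := by
    intro p hp
    simp only [Finset.mem_insert, Finset.mem_singleton] at hp
    refine ⟨?_, fun q hq => ?_⟩
    · rcases hp with rfl | rfl
      · rw [htF a (by simp), htF' x (by simp), hca, hx']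
      · rw [htF b (by simp), htF' y (by simp), hcb, hy']
    · simp only [Finset.mem_insert, Finset.mem_singleton] at hq
      rcases hp with rfl | rfl <;> rcases hq with rfl | rfl <;>
        simp [h1, h2, h1.not_gt, h2.not_gt]
  obtain ⟨g, -, hg⟩ := exists_aut_extending ht ht' hiso
  have hgx : g⁻¹ x = a := by
    rw [← show g a = x from hg (a, x) (by simp), RelIso.inv_apply_self]
  have hgy : g⁻¹ y = b := by
    rw [← show g b = y from hg (b, y) (by simp), RelIso.inv_apply_self]
  refine ⟨g • coding.symm u, ?_, MulAction.mem_orbit _ _⟩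
  obtain ⟨w, hw⟩ := coding.symm.surjective (g • coding.symm u)
  have hw' : tri w = translate g (tri u) := congrArg Subtype.val hw
  rw [← hw]
  refine hIV ⟨?_, ?_⟩
  · rw [← tri_eq_true, hw', translate_apply, hgx, tri_eq_true_iff, hca]
  · rw [← tri_eq_true, hw', translate_apply, hgy, tri_eq_true_iff, hcb]

theorem isCompactMinimalFlow_orbitClosure : IsCompactMinimalFlow AutS3 orbitClosure where
  nonempty := ⟨coding.symm (single startPt startPt_notMem)⟩
  compact := inferInstance
  hausdorff := inferInstance
  continuous := inferInstance
  minimal := closure_orbit_eq_univ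

/-! ### Extreme amenability of the stabilizer of the sectors -/

/-- The cut whose triple is the triple of sectors. -/
noncomputable def startCut : DoubledCircle := single startPt startPt_notMem

/-- The automorphisms that preserve the three sectors. -/
def sectorStabilizer : Set AutS3 := {g | ∀ x, colour startCut (g x) = colour startCut x}

theorem inv_mem_sectorStabilizer {g : AutS3} (hg : g ∈ sectorStabilizer) :
    g⁻¹ ∈ sectorStabilizer := fun x => by
  rw [← hg (g⁻¹ x), RelIso.apply_inv_self]

/-- Each block holds one point of every colour, so a coloured configuration can be realized by
choosing only increasing block numbers, to which the uncoloured Ramsey theorem applies. -/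
theorem exists_blocks : ∃ z : ℕ → Fin 3 → S, (∀ m j, colour startCut (z m j) = j) ∧
    ∀ m n i j, m < n → position startCut (z m i) < position startCut (z n j) := by
  obtain ⟨a, ha, ha', -⟩ := exists_seq_strictMono_tendsto' third_pos
  have : ∀ m j, ∃ x : S, colour startCut x = j ∧ a m < position startCut x ∧
      position startCut x < a (m + 1) := fun m j =>
    (isDenseColouring startPt startPt_notMem).dense j _ _ (ha' m).1.le
      (ha (Nat.lt_succ_self m)) (ha' _).2.le
  choose z hz1 hz2 hz3 using this
  exact ⟨z, hz1, fun m n i j h => ((hz3 m i).trans_le (ha.monotone h)).trans (hz2 n j)⟩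

theorem exists_monochromatic {κ : Type*} [Finite κ] (F : Finset S) (K : Finset AutS3)
    (hK : ∀ k ∈ K, k ∈ sectorStabilizer) (χ : (F → S) → κ) :
    ∃ h ∈ sectorStabilizer, ∃ col, ∀ k ∈ K, χ (fun x => h (k x)) = col := by
  classical
  obtain ⟨z, hz1, hz2⟩ := exists_blocks
  obtain ⟨H, hH, col, hcol⟩ := exists_strictMono_monochromatic_of_injective
    (pos := fun x : F => position startCut x)
    ((position_injective startCut).comp Subtype.val_injective)
    fun f : F → ℕ => χ fun x => z (f x) (colour startCut x)
  let B : Finset S := K.biUnion fun k => F.image k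
  -- Points of `B` are sent to the Ramsey blocks according to their rank in `B`. For each `k` in
  -- `K`, the ranks of the `k x` then increase with the position of `x`.
  let rank : S → ℕ := fun b => (B.filter fun b' => position startCut b' < position startCut b).card
  have hrank : ∀ b ∈ B, ∀ b', position startCut b < position startCut b' → rank b < rank b' := by
    intro b hb b' h
    refine Finset.card_lt_card ⟨fun c hc => ?_, fun hsub => ?_⟩
    · simp only [Finset.mem_filter] at hc ⊢
      exact ⟨hc.1, hc.2.trans h⟩
    · have := hsub (Finset.mem_filter.2 ⟨hb, h⟩)
      exact lt_irrefl _ (Finset.mem_filter.1 this).2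
  let ψ : S → S := fun b => z (H (rank b)) (colour startCut b)
  have hψ : ∀ b ∈ B, ∀ b', position startCut b < position startCut b' →
      position startCut (ψ b) < position startCut (ψ b') := fun b hb b' h =>
    hz2 _ _ _ _ (hH (hrank b hb b' h))
  have hiso : IsPartialIso (colour startCut) (position startCut) (colour startCut)
      (position startCut) (B.image fun b => (b, ψ b)) := by
    intro p hp
    obtain ⟨b, hb, rfl⟩ := Finset.mem_image.1 hp
    refine ⟨(hz1 _ _).symm, fun q hq => ?_⟩
    obtain ⟨b', hb', rfl⟩ := Finset.mem_image.1 hq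
    refine ⟨hψ b hb b', fun h => ?_⟩
    rcases lt_trichotomy (position startCut b) (position startCut b') with h' | h' | h'
    · exact h'
    · rw [position_injective _ h'] at h
      exact absurd h (lt_irrefl _)
    · exact absurd h (hψ b' hb' b h').asymm
  obtain ⟨h, h1, h2⟩ := exists_aut_extending startPt_notMem startPt_notMem hiso
  refine ⟨h, h1, col, fun k hk => ?_⟩
  have hkB : ∀ x ∈ F, k x ∈ B := fun x hx =>
    Finset.mem_biUnion.2 ⟨k, hk, Finset.mem_image_of_mem _ hx⟩
  rw [← hcol (fun x => rank (k x)) fun x y hxy => hrank _ (hkB x x.2) _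
    ((position_lt_apply_iff (hK k hk x) (hK k hk y)).2 hxy)]
  congr 1
  funext x
  rw [h2 (k x, ψ (k x)) (Finset.mem_image_of_mem _ (hkB x x.2))]
  simp only [ψ, Function.comp_apply, hK k hk x]

theorem exists_finset_of_mem_nhds_one {N : Set AutS3} (hN : N ∈ 𝓝 (1 : AutS3)) :
    ∃ F : Finset S, ∀ g : AutS3, (∀ x ∈ F, g x = x) → g ∈ N := by
  classical
  obtain ⟨_, ⟨f, ⟨hf, hfs⟩, rfl⟩, h1, hsub⟩ :=
    (TopologicalSpace.isTopologicalBasis_of_subbasis rfl).mem_nhds_iff.1 hN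
  have : ∀ U ∈ f, ∃ x : S, ∀ g : AutS3, g x = x → g ∈ U := by
    intro U hU
    obtain ⟨x, y, rfl⟩ := hfs hU
    have hxy : x = y := h1 _ hU
    exact ⟨x, fun g hg => hg.trans hxy⟩
  have : Nonempty S := ⟨⟨_, 0, rfl⟩⟩
  choose! x hx using ‹∀ U ∈ f, ∃ x : S, ∀ g : AutS3, g x = x → g ∈ U›
  refine ⟨hf.toFinset.image x, fun g hg => hsub fun U hU => hx U hU g (hg _ ?_)⟩
  exact Finset.mem_image_of_mem _ (hf.mem_toFinset.2 hU)

theorem sectors_mem : sectors ∈ orbitClosure := sectors_eq ▸ tri_mem_orbitClosure _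

section Factor

variable {Y : Type*} [UniformSpace Y] [MulAction AutS3 Y]

open scoped SetRel

theorem exists_smul_mem_of_mem_closure {y₀ y : Y} {T : orbitClosure}
    (h : (T, y) ∈ closure
      (range fun g : AutS3 => (g • (⟨sectors, sectors_mem⟩ : orbitClosure), g • y₀)))
    (F : Finset S) {V : Set (Y × Y)} (hV : V ∈ 𝓤 Y) :
    ∃ g : AutS3, (∀ x ∈ F, ∀ j, translate g sectors j x = (T : Triples) j x) ∧ (y, g • y₀) ∈ V := by
  have hU : {T' : orbitClosure | ∀ x ∈ F, ∀ j, (T' : Triples) j x = (T : Triples) j x} ∈ 𝓝 T := by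
    refine IsOpen.mem_nhds ?_ fun x _ j => rfl
    simp only [ofPred_forall]
    refine isOpen_biInter_finset fun x _ => isOpen_iInter_of_finite fun j => ?_
    exact (isOpen_discrete ({(T : Triples) j x} : Set Bool)).preimage
      (((continuous_apply x).comp (continuous_apply j) : Continuous fun T' : Triples =>
        T' j x).comp continuous_subtype_val)
  obtain ⟨_, ⟨h1, h2⟩, g, rfl⟩ := mem_closure_iff_nhds.1 h _
    (prod_mem_nhds hU (UniformSpace.ball_mem_nhds y hV))
  exact ⟨g, h1, h2⟩

variable [CompactSpace Y] [ContinuousSMul AutS3 Y]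

/-- Compactness of `Y` makes the smallness of the action near `1` uniform in the point. -/
theorem exists_finset_forall_smul_mem {V : Set (Y × Y)} (hV : V ∈ 𝓤 Y) :
    ∃ F : Finset S, ∀ g : AutS3, (∀ x ∈ F, g x = x) → ∀ y : Y, (y, g • y) ∈ V := by
  have h : ∀ᶠ g in 𝓝 (1 : AutS3), ∀ y ∈ (univ : Set Y), (y, g • y) ∈ V := by
    refine isCompact_univ.eventually_forall_of_forall_eventually fun y _ => ?_
    have hc : Continuous fun p : AutS3 × Y => (p.2, p.1 • p.2) := by fun_prop
    refine hc.continuousAt.eventually (p := fun q => q ∈ V) ?_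
    simp only [one_smul]
    exact nhds_le_uniformity y hV
  obtain ⟨F, hF⟩ := exists_finset_of_mem_nhds_one h
  exact ⟨F, fun g hg y => hF g hg y (mem_univ y)⟩

theorem exists_almost_fixed [Nonempty Y] (K : Finset AutS3) (hK : ∀ k ∈ K, k ∈ sectorStabilizer)
    {V : Set (Y × Y)} (hV : V ∈ 𝓤 Y) : ∃ y : Y, ∀ k ∈ K, (y, k • y) ∈ V := by
  classical
  obtain ⟨V', hV', hVs, hV'V⟩ := comp_symm_mem_uniformity_sets hV
  obtain ⟨W, hW, -, hWV'⟩ := comp_symm_mem_uniformity_sets hV'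
  obtain ⟨F, hF⟩ := exists_finset_forall_smul_mem hW
  obtain ⟨t, ht, hcov⟩ := isCompact_univ.totallyBounded W hW
  have hcov' : ∀ y : Y, ∃ c ∈ t, (y, c) ∈ W := fun y => by simpa using hcov (mem_univ y)
  have : Finite t := ht
  have y₀ : Y := Classical.arbitrary Y
  -- The restriction of `g` to `F` determines `g⁻¹ • y₀` up to `W`, hence a nearby centre of a
  -- finite cover; this is the colouring. The inverse is needed because automorphisms agreeing on
  -- `F` differ on the right by one fixing `F`. Maps that no automorphism extends get an arbitrary
  -- colour.
  have hcol : ∀ φ : F → S, ∃ c : t, ∀ g : AutS3, (∀ x : F, g x = φ x) →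
      (g⁻¹ • y₀, (c : Y)) ∈ W ○ W := by
    intro φ
    by_cases hφ : ∃ g : AutS3, ∀ x : F, g x = φ x
    · obtain ⟨g, hg⟩ := hφ
      obtain ⟨c, hc, hgc⟩ := hcov' (g⁻¹ • y₀)
      refine ⟨⟨c, hc⟩, fun g' hg' => ⟨g⁻¹ • y₀, ?_, hgc⟩⟩
      have h1 := hF (g⁻¹ * g') (fun x hx => by
        rw [RelIso.mul_apply, hg' ⟨x, hx⟩, ← hg ⟨x, hx⟩, RelIso.inv_apply_self]) (g'⁻¹ • y₀)
      rwa [smul_smul, mul_assoc, mul_inv_cancel, mul_one] at h1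
    · obtain ⟨c, hc, -⟩ := hcov' y₀
      exact ⟨⟨c, hc⟩, fun g hg => absurd ⟨g, hg⟩ hφ⟩
  choose χ hχ using hcol
  -- Inverses are used since `(h * k⁻¹)⁻¹ • y₀ = k • h⁻¹ • y₀`, and `1` is added to compare with
  -- `h⁻¹ • y₀` itself.
  obtain ⟨h, -, col, hcol⟩ := exists_monochromatic F (insert 1 (K.image (·⁻¹))) (by
    intro k hk
    rcases Finset.mem_insert.1 hk with rfl | hk
    · exact fun x => rfl
    · obtain ⟨k, hk', rfl⟩ := Finset.mem_image.1 hk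
      exact inv_mem_sectorStabilizer (hK k hk')) χ
  have key : ∀ k ∈ insert 1 (K.image (·⁻¹)), ((h * k)⁻¹ • y₀, (col : Y)) ∈ V' := fun k hk => by
    rw [← hcol k hk]
    exact hWV' (hχ _ (h * k) fun x => rfl)
  refine ⟨h⁻¹ • y₀, fun k hk => hV'V ⟨(col : Y), ?_, hVs.symm _ _ ?_⟩⟩
  · simpa using key 1 (Finset.mem_insert_self _ _)
  · have := key k⁻¹ (Finset.mem_insert_of_mem (Finset.mem_image_of_mem _ hk))
    rwa [mul_inv_rev, inv_inv, mul_smul] at this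

/-- The closed sets of points moved within a closed entourage by one stabilizer element have the
finite intersection property, by `exists_almost_fixed`. -/
theorem exists_fixed [T2Space Y] [Nonempty Y] : ∃ y : Y, ∀ k ∈ sectorStabilizer, k • y = y := by
  classical
  let ι := sectorStabilizer × {V : Set (Y × Y) // V ∈ 𝓤 Y ∧ IsClosed V}
  let t : ι → Set Y := fun i => {y | (y, i.1.1 • y) ∈ i.2.1}
  have ht : ∀ i, IsClosed (t i) := fun i => i.2.2.2.preimage
    (continuous_id.prodMk (continuous_const_smul i.1.1))
  obtain ⟨y, -, hy⟩ := isCompact_univ.inter_iInter_nonempty t ht fun s => by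
    obtain ⟨y, hy⟩ := exists_almost_fixed (Y := Y) (s.image fun i => i.1.1)
      (fun k hk => by
        obtain ⟨i, -, rfl⟩ := Finset.mem_image.1 hk
        exact i.1.2)
      ((Filter.biInter_finset_mem s).2 fun i _ => i.2.2.1)
    refine ⟨y, mem_univ y, mem_iInter₂.2 fun i hi => ?_⟩
    exact mem_iInter₂.1 (hy _ (Finset.mem_image_of_mem _ hi)) i hi
  refine ⟨y, fun k hk => (eq_of_uniformity_basis uniformity_hasBasis_closed fun {V} hV => ?_).symm⟩
  exact mem_iInter.1 hy (⟨k, hk⟩, ⟨V, hV⟩)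

/-! ### Factor maps from `X*` onto minimal flows -/

/-- Two translates of the sectors that agree on a finite set differ by a small automorphism. -/
theorem exists_mul_eq_mul {F : Finset S} {g g' : AutS3}
    (h : ∀ x ∈ F, ∀ j, translate g sectors j x = translate g' sectors j x) :
    ∃ k ∈ sectorStabilizer, ∃ v : AutS3, (∀ x ∈ F, v x = x) ∧ v * g = g' * k := by
  classical
  have hc : ∀ x ∈ F, colour startCut (g⁻¹ x) = colour startCut (g'⁻¹ x) := by
    intro x hx
    rw [colour_eq_iff]
    rw [sectors_eq] at h
    exact h x hx
  have hiso : IsPartialIso (colour startCut) (position startCut) (colour startCut)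
      (position startCut) (F.image fun x => (g⁻¹ x, g'⁻¹ x)) := by
    intro p hp
    obtain ⟨x, hx, rfl⟩ := Finset.mem_image.1 hp
    refine ⟨hc x hx, fun q hq => ?_⟩
    obtain ⟨y, hy, rfl⟩ := Finset.mem_image.1 hq
    rw [position_lt_iff, position_lt_iff, hc x hx, hc y hy, arc_rho_apply, arc_rho_apply]
  obtain ⟨k, hk, hkF⟩ := exists_aut_extending startPt_notMem startPt_notMem hiso
  refine ⟨k, hk, g' * k * g⁻¹, fun x hx => ?_, by group⟩
  have h1 : k (g⁻¹ x) = g'⁻¹ x := hkF (g⁻¹ x, g'⁻¹ x) (Finset.mem_image_of_mem _ hx)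
  rw [RelIso.mul_apply, RelIso.mul_apply, h1, RelIso.apply_inv_self]

/-- Single-valuedness of the closure of the joint orbit, which is to be the graph of the factor map.
-/
theorem eq_of_mem_closure [T2Space Y] {y₀ : Y} (hy₀ : ∀ k ∈ sectorStabilizer, k • y₀ = y₀)
    {y y' : Y} {T : orbitClosure}
    (h : (T, y) ∈ closure
      (range fun g : AutS3 => (g • (⟨sectors, sectors_mem⟩ : orbitClosure), g • y₀)))
    (h' : (T, y') ∈ closure
      (range fun g : AutS3 => (g • (⟨sectors, sectors_mem⟩ : orbitClosure), g • y₀))) :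
    y = y' := by
  refine eq_of_uniformity fun {V} hV => ?_
  obtain ⟨W, hW, hWs, hWV⟩ := comp_comp_symm_mem_uniformity_sets hV
  obtain ⟨F, hF⟩ := exists_finset_forall_smul_mem hW
  obtain ⟨g, hg, hgy⟩ := exists_smul_mem_of_mem_closure h F hW
  obtain ⟨g', hg', hgy'⟩ := exists_smul_mem_of_mem_closure h' F hW
  obtain ⟨k, hk, v, hv, hvk⟩ := exists_mul_eq_mul (F := F) (g := g) (g' := g') fun x hx j => by
    rw [hg x hx, hg' x hx]
  have h1 : (g • y₀, g' • y₀) ∈ W := by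
    have := hF v hv (g • y₀)
    rwa [smul_smul, hvk, mul_smul, hy₀ k hk] at this
  exact hWV ⟨_, ⟨_, hgy, h1⟩, hWs.symm _ _ hgy'⟩

theorem exists_factor_map [T2Space Y] [Nonempty Y]
    (hmin : ∀ y : Y, closure (MulAction.orbit AutS3 y) = univ) :
    ∃ π : orbitClosure → Y, Continuous π ∧ Function.Surjective π ∧
      ∀ (g : AutS3) (T : orbitClosure), π (g • T) = g • π T := by
  obtain ⟨y₀, hy₀⟩ := exists_fixed (Y := Y)
  let T₀ : orbitClosure := ⟨sectors, sectors_mem⟩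
  let Γ : Set (orbitClosure × Y) := closure (range fun g : AutS3 => (g • T₀, g • y₀))
  have hclosed : IsClosed Γ := isClosed_closure
  have hex : ∀ T : orbitClosure, ∃ y, (T, y) ∈ Γ := by
    have h1 : IsClosed (Prod.fst '' Γ) := (hclosed.isCompact.image continuous_fst).isClosed
    have h2 : MulAction.orbit AutS3 T₀ ⊆ Prod.fst '' Γ := by
      rintro _ ⟨g, rfl⟩
      exact ⟨(g • T₀, g • y₀), subset_closure ⟨g, rfl⟩, rfl⟩
    have h3 := closure_minimal h2 h1
    rw [closure_orbit_eq_univ] at h3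
    intro T
    obtain ⟨⟨T, y⟩, hy, rfl⟩ := h3 (mem_univ T)
    exact ⟨y, hy⟩
  choose π hπ using hex
  have huniq : ∀ {T y}, (T, y) ∈ Γ → y = π T := fun h => eq_of_mem_closure hy₀ h (hπ _)
  -- A map with closed graph between compact Hausdorff spaces is continuous.
  have hcont : Continuous π := by
    refine continuous_iff_isClosed.2 fun C hC => ?_
    have : π ⁻¹' C = Prod.fst '' (Γ ∩ Prod.snd ⁻¹' C) := by
      ext T
      constructor
      · exact fun h => ⟨(T, π T), ⟨hπ T, h⟩, rfl⟩
      · rintro ⟨⟨T, y⟩, ⟨h1, h2⟩, rfl⟩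
        change π T ∈ C
        rw [← huniq h1]
        exact h2
    rw [this]
    exact ((hclosed.inter (hC.preimage continuous_snd)).isCompact.image continuous_fst).isClosed
  have hequiv : ∀ (g : AutS3) (T : orbitClosure), π (g • T) = g • π T := by
    intro g T
    refine (huniq ?_).symm
    refine map_mem_closure (f := fun p : orbitClosure × Y => (g • p.1, g • p.2)) (by fun_prop)
      (hπ T) ?_
    rintro _ ⟨h, rfl⟩
    exact ⟨g * h, by simp only [mul_smul]⟩
  refine ⟨π, hcont, fun y => ?_, hequiv⟩
  have h1 : MulAction.orbit AutS3 (π T₀) ⊆ range π := by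
    rintro _ ⟨g, rfl⟩
    exact ⟨g • T₀, hequiv g T₀⟩
  have h2 := closure_minimal h1 (isCompact_range hcont).isClosed
  rw [hmin] at h2
  exact h2 (mem_univ y)

end Factor

theorem isUniversalMinimalFlow_orbitClosure : IsUniversalMinimalFlow.{u} AutS3 orbitClosure := by
  refine ⟨isCompactMinimalFlow_orbitClosure, fun Y _ _ hY => ?_⟩
  obtain ⟨h1, h2, h3, h4, h5⟩ := hY
  let : UniformSpace Y := uniformSpaceOfCompactR1
  exact exists_factor_map h5

end CircularDigraph

/-! ### Transport to the doubled circle -/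

theorem IsUniversalMinimalFlow.of_homeomorph {G X Z : Type*} [Group G] [TopologicalSpace G]
    [IsTopologicalGroup G] [TopologicalSpace X] [TopologicalSpace Z] [MulAction G X]
    [MulAction G Z] (φ : X ≃ₜ Z) (hφ : ∀ (g : G) (x : X), φ (g • x) = g • φ x)
    (h : IsUniversalMinimalFlow.{u} G X) : IsUniversalMinimalFlow.{u} G Z := by
  obtain ⟨⟨h1, h2, h3, h4, h5⟩, huniv⟩ := h
  have hφ' : ∀ (g : G) (z : Z), φ.symm (g • z) = g • φ.symm z := fun g z => by
    rw [Homeomorph.symm_apply_eq, hφ, Homeomorph.apply_symm_apply]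
  refine ⟨⟨h1.map φ, φ.compactSpace, φ.t2Space, ⟨?_⟩, fun z => ?_⟩, fun Y _ _ hY => ?_⟩
  · have : (fun p : G × Z => p.1 • p.2) = fun p => φ (p.1 • φ.symm p.2) := by
      funext p
      rw [hφ, Homeomorph.apply_symm_apply]
    rw [this]
    fun_prop
  · have : MulAction.orbit G z = φ '' MulAction.orbit G (φ.symm z) := by
      rw [MulAction.orbit, MulAction.orbit, ← range_comp]
      congr 1
      funext g
      simp [hφ]
    rw [this, ← φ.image_closure, h5, image_univ, φ.surjective.range_eq]
  · obtain ⟨π, h6, h7, h8⟩ := huniv Y hY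
    exact ⟨π ∘ φ.symm, h6.comp φ.symm.continuous, h7.comp φ.symm.surjective, fun g z => by
      simp [hφ', h8]⟩

theorem mainTheorem6 :
    TopologicalSpace.IsTopologicalBasis CircularDigraph.intervals ∧
    ∃ φ : CircularDigraph.orbitClosure ≃ₜ CircularDigraph.DoubledCircle,
      (∀ (T : CircularDigraph.orbitClosure) (x : CircularDigraph.DoubledCircle),
        φ T = x ↔ CircularDigraph.Codes T x) ∧
      ∃ _action : MulAction CircularDigraph.AutS3 CircularDigraph.DoubledCircle,
        (∀ (g : CircularDigraph.AutS3) (T : CircularDigraph.orbitClosure),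
          φ (g • T) = g • φ T) ∧
        IsUniversalMinimalFlow.{u} CircularDigraph.AutS3 CircularDigraph.DoubledCircle := by
  refine ⟨CircularDigraph.isTopologicalBasis_intervals, CircularDigraph.coding,
    CircularDigraph.coding_eq_iff,
    CircularDigraph.coding.symm.toEquiv.mulAction CircularDigraph.AutS3, ?_⟩
  let := CircularDigraph.coding.symm.toEquiv.mulAction CircularDigraph.AutS3
  have h : ∀ (g : CircularDigraph.AutS3) (T : CircularDigraph.orbitClosure),
      CircularDigraph.coding (g • T) = g • CircularDigraph.coding T := fun g T =>
    (congrArg (fun T' => CircularDigraph.coding (g • T'))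
      (CircularDigraph.coding.symm_apply_apply T)).symm
  exact ⟨h, .of_homeomorph _ h CircularDigraph.isUniversalMinimalFlow_orbitClosure⟩
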